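/- **Setting.** Let $k$ be a field. A bound quiver $Q=(Q_0,Q_1,\rho)$ is a quiver with a set $\rho$ of relations, each a linear combination of paths of the same length $\ge 2$ with the same starting vertex and the same ending vertex. Algebras are associative $k$-algebras, possibly without an identity; $kQ$ has the paths as a basis (including the trivial paths $e_i$), with $qp$ meaning "first $p$, then $q$". Put $\Lambda=kQ/(\rho)=\bigoplus_{t\ge0}\Lambda_t$, graded by path length, and assume that every $e_j\Lambda e_i$ is finite dimensional ($Q_0$ may be infinite). A path is *bound* if its image in $\Lambda$ is nonzero, and a bound path is *maximal* if it is not a proper subpath of a bound path. $Q$ is *acyclic* if it has no oriented cycles, and *$n$-homogeneous* if all maximal bound paths have length $n$ and no bound path is longer than $n$. Let $D\Lambda=\bigoplus_{i,j}\operatorname{Hom}_k(e_j\Lambda e_i,k)$ be the dual bimodule, $(a\varphi b)(x)=\varphi(bxa)$, and let $\Delta\Lambda=\Lambda\ltimes D\Lambda$ be the trivial extension, i.e. $\Lambda\oplus D\Lambda$ with $(a,x)(b,y)=(ab,ay+xb)$. Let $Q$ be $n$-homogeneous, and let $\mathcal M$ be a maximal linearly independent set (in $\Lambda$) of maximal bound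 paths; it is a basis of $\Lambda_n$. For $p\in\mathcal M$ let $p^*\in D\Lambda_n\subseteq D\Lambda$ be the corresponding element of the dual basis. The returning arrow quiver $\widetilde Q$ is $Q$ with an additional arrow $\beta_p:t(p)\to s(p)$ for each $p\in\mathcal M$, and $\mu:k\widetilde Q\to\Delta\Lambda$ is the homomorphism with $e_i\mapsto(e_i,0)$, $\alpha\mapsto(\alpha,0)$ for $\alpha\in Q_1$, and $\beta_p\mapsto(0,p^*)$. We say that $\Delta\Lambda$ is *quadratic* if $\mu$ is surjective and $\ker\mu$ is generated as an ideal by its elements that are linear combinations of paths of length $2$ (that is, $\Delta\Lambda$ is a quadratic algebra for the grading with degree $0$ part $\Lambda_0$ and degree $1$ part $\Lambda_1+D\Lambda_n$). Let $V=kQ_1$ and let $V_{\mathcal M}$ be the span of the $\beta_p$; tensor products are over $\Lambda_0$. Let $\rho'$ be a spanning set (e.g. a basis) of $\ker\mu\cap(V\otimes V)$, let $\rho_0$ be a spanning set of $\ker\mu\cap(V\otimes V_{\mathcal M}+V_{\mathcal M}\otimes V)$, both consisting of linear combinations of paths with common starting and ending vertices, and let $\rho_{\mathcal M}$ be the set of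 all paths $\beta_{p'}\beta_p$. The bound quiver $\mathbb Z|_{n-1}Q$ has vertices $(i,t)$ for $i\in Q_0$, $t\in\mathbb Z$; arrows $(\alpha,t):(i,t)\to(j,t)$ for each arrow $\alpha:i\to j$ of $Q$, and $(\beta_p,t):(t(p),t)\to(s(p),t+1)$ for each $p\in\mathcal M$; and as relations, for each $t\in\mathbb Z$, the lifts of the elements of $\rho'\cup\rho_{\mathcal M}\cup\rho_0$ starting on level $t$ (each path is replaced by its unique lift starting on level $t$). For a $\mathbb Z$-graded algebra $A$, the smash product $A\#k\mathbb Z^*$ consists of the finite sums $\sum_t a_tp_t$ ($a_t\in A$, $t\in\mathbb Z$) with $(ap_s)(bp_t)=a\,b_{s-t}\,p_t$, where $b_d$ is the component of $b$ of degree $d$. An algebra $B$ is *self-injective* if it has local identities (every finite subset lies in $eBe$ for an idempotent $e$) and, for every idempotent $e\in B$, the module $Be$ is injective in the category of unital left $B$-modules ($BM=M$) and $eB$ is injective in the category of unital right $B$-modules. **Proposition 6.2.** Assume that $Q$ is acyclic and $n$-homogeneous and that $\Delta\Lambda$ is quadratic. Grade $\Delta\Lambda$ by putting $\Lambda$ in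 degree $0$ and the elements $p^*$ ($p\in\mathcal M$), hence all of $D\Lambda$, in degree $1$. Then $\Delta\Lambda\#k\mathbb Z^*$ is a self-injective algebra with bound quiver $\mathbb Z|_{n-1}Q$: there is an isomorphism of $k$-algebras $$k(\mathbb Z|_{n-1}Q)/(\rho_{\mathbb Z|_{n-1}Q})\;\xrightarrow{\ \sim\ }\;\Delta\Lambda\#k\mathbb Z^*,\qquad e_{(i,t)}\mapsto(e_i,0)\,p_t,\quad(\alpha,t)\mapsto(\alpha,0)\,p_t,\quad(\beta_p,t)\mapsto(0,p^*)\,p_t .$$ -/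

import Mathlib

universe u v w uk uB uI

set_option linter.unusedSectionVars false
set_option linter.unusedVariables false

noncomputable section

namespace QuiverAlg

open scoped Classical

/-! ### Algebras that need not have an identity: ideals, quotients, trivial extensions

Algebras are associative `k`-algebras without a global identity, since the algebra of an infinite
quiver has only local identities. -/

section Algebras

variable (k : Type*) [Field k] {A : Type*} [NonUnitalRing A] [Module k A]

/-- The two-sided ideal `(R)` of the `k`-algebra `A` generated by a set `R`. -/
def idealSpan (R : Set A) : Submodule k A :=
  sInf {I | R ⊆ I ∧ ∀ a x, x ∈ I → a * x ∈ I ∧ x * a ∈ I}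

lemma subset_idealSpan (R : Set A) : R ⊆ idealSpan k R := by
  intro x hx
  simp only [idealSpan, SetLike.mem_coe, Submodule.mem_sInf]
  exact fun I hI => hI.1 hx

lemma idealSpan_mul_mem (R : Set A) (a x : A) (hx : x ∈ idealSpan k R) :
    a * x ∈ idealSpan k R ∧ x * a ∈ idealSpan k R := by
  simp only [idealSpan, Submodule.mem_sInf] at hx ⊢
  exact ⟨fun I hI => (hI.2 a x (hx I hI)).1, fun I hI => (hI.2 a x (hx I hI)).2⟩

lemma idealSpan_le (R : Set A) (I : Submodule k A) (h : R ⊆ I)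
    (hI : ∀ a x, x ∈ I → a * x ∈ I ∧ x * a ∈ I) : idealSpan k R ≤ I :=
  sInf_le ⟨h, hI⟩

/-- The quotient algebra `A / (R)`. -/
def AlgQuot (R : Set A) : Type _ := A ⧸ idealSpan k R

namespace AlgQuot

variable (R : Set A)

instance : AddCommGroup (AlgQuot k R) := inferInstanceAs (AddCommGroup (A ⧸ idealSpan k R))
instance : Module k (AlgQuot k R) := inferInstanceAs (Module k (A ⧸ idealSpan k R))

/-- The quotient map `A → A / (R)`. -/
def mk : A →ₗ[k] AlgQuot k R := (idealSpan k R).mkQ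

lemma mk_surjective : Function.Surjective (mk k R) := Submodule.mkQ_surjective _

lemma mk_eq_iff (x y : A) : mk k R x = mk k R y ↔ x - y ∈ idealSpan k R :=
  Submodule.Quotient.eq (idealSpan k R)

instance : Mul (AlgQuot k R) :=
  ⟨Quotient.map₂ (· * ·) (by
    intro a a' ha b b' hb
    rw [← Quotient.eq_iff_equiv] at ha hb ⊢
    have h1 : a - a' ∈ idealSpan k R := (mk_eq_iff k R a a').1 ha
    have h2 : b - b' ∈ idealSpan k R := (mk_eq_iff k R b b').1 hb
    refine (mk_eq_iff k R (a * b) (a' * b')).2 ?_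
    have : a * b - a' * b' = (a - a') * b + a' * (b - b') := by noncomm_ring
    rw [this]
    exact add_mem (idealSpan_mul_mem k R b _ h1).2 (idealSpan_mul_mem k R a' _ h2).1)⟩

lemma mk_mul (x y : A) : mk k R (x * y) = mk k R x * mk k R y := rfl

instance : NonUnitalRing (AlgQuot k R) where
  left_distrib a b c := by
    obtain ⟨a, rfl⟩ := mk_surjective k R a
    obtain ⟨b, rfl⟩ := mk_surjective k R b
    obtain ⟨c, rfl⟩ := mk_surjective k R c
    simp only [← map_add, ← mk_mul, mul_add]
  right_distrib a b c := by
    obtain ⟨a, rfl⟩ := mk_surjective k R a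
    obtain ⟨b, rfl⟩ := mk_surjective k R b
    obtain ⟨c, rfl⟩ := mk_surjective k R c
    simp only [← map_add, ← mk_mul, add_mul]
  zero_mul a := by
    obtain ⟨a, rfl⟩ := mk_surjective k R a
    rw [← map_zero (mk k R), ← mk_mul, zero_mul]
  mul_zero a := by
    obtain ⟨a, rfl⟩ := mk_surjective k R a
    rw [← map_zero (mk k R), ← mk_mul, mul_zero]
  mul_assoc a b c := by
    obtain ⟨a, rfl⟩ := mk_surjective k R a
    obtain ⟨b, rfl⟩ := mk_surjective k R b
    obtain ⟨c, rfl⟩ := mk_surjective k R c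
    simp only [← mk_mul, mul_assoc]

instance [IsScalarTower k A A] : IsScalarTower k (AlgQuot k R) (AlgQuot k R) := ⟨by
  intro c a b
  obtain ⟨a, rfl⟩ := mk_surjective k R a
  obtain ⟨b, rfl⟩ := mk_surjective k R b
  simp only [smul_eq_mul, ← map_smul, ← mk_mul, smul_mul_assoc]⟩

instance [SMulCommClass k A A] : SMulCommClass k (AlgQuot k R) (AlgQuot k R) := ⟨by
  intro c a b
  obtain ⟨a, rfl⟩ := mk_surjective k R a
  obtain ⟨b, rfl⟩ := mk_surjective k R b
  simp only [smul_eq_mul, ← map_smul, ← mk_mul, mul_smul_comm]⟩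

end AlgQuot

variable [IsScalarTower k A A] [SMulCommClass k A A]

/-- The functional `x ↦ f (b x a)`, that is, `a f b` for the natural bimodule structure on the
space of linear functionals on `A`. -/
def biAct (a b : A) (f : A →ₗ[k] k) : A →ₗ[k] k :=
  f ∘ₗ LinearMap.mulRight k a ∘ₗ LinearMap.mulLeft k b

variable (A) in
/-- The dual bimodule `D A`, formed locally: the span of the functionals `a f b` (`x ↦ f (b x a)`)
with `f` a linear functional on `A`. If `A` has an identity these are all linear functionals. If
`A = ⊕ e_j A e_i` for a complete set of orthogonal idempotents, these are the functionals that
vanish on all but finitely many of the blocks `e_j A e_i`, that is, `D A = ⊕ D (e_j A e_i)`. -/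
def localDual : Submodule k (A →ₗ[k] k) :=
  Submodule.span k {φ | ∃ a b f, φ = biAct k a b f}

lemma biAct_mem (a b : A) (f : A →ₗ[k] k) : biAct k a b f ∈ localDual k A :=
  Submodule.subset_span ⟨a, b, f, rfl⟩

/-- The left action `(a φ)(x) = φ (x a)` on functionals. -/
def lAct (a : A) : (A →ₗ[k] k) →ₗ[k] (A →ₗ[k] k) := LinearMap.lcomp k k (LinearMap.mulRight k a)

/-- The right action `(φ b)(x) = φ (b x)` on functionals. -/
def rAct (b : A) : (A →ₗ[k] k) →ₗ[k] (A →ₗ[k] k) := LinearMap.lcomp k k (LinearMap.mulLeft k b)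

@[simp] lemma lAct_apply (a : A) (φ : A →ₗ[k] k) (x : A) : lAct k a φ x = φ (x * a) := rfl
@[simp] lemma rAct_apply (b : A) (φ : A →ₗ[k] k) (x : A) : rAct k b φ x = φ (b * x) := rfl

lemma lAct_mem (a : A) (φ : A →ₗ[k] k) (h : φ ∈ localDual k A) : lAct k a φ ∈ localDual k A := by
  refine Submodule.span_induction (p := fun φ _ => lAct k a φ ∈ localDual k A) ?_ ?_ ?_ ?_ h
  · rintro _ ⟨c, b, f, rfl⟩
    refine Submodule.subset_span ⟨a * c, b, f, ?_⟩
    ext x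
    simp [biAct, mul_assoc]
  · simp
  · intro x y _ _ hx hy
    rw [map_add]
    exact add_mem hx hy
  · intro c x _ hx
    rw [map_smul]
    exact Submodule.smul_mem _ _ hx

lemma rAct_mem (b : A) (φ : A →ₗ[k] k) (h : φ ∈ localDual k A) : rAct k b φ ∈ localDual k A := by
  refine Submodule.span_induction (p := fun φ _ => rAct k b φ ∈ localDual k A) ?_ ?_ ?_ ?_ h
  · rintro _ ⟨a, c, f, rfl⟩
    refine Submodule.subset_span ⟨a, c * b, f, ?_⟩
    ext x
    simp [biAct, mul_assoc]
  · simp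
  · intro x y _ _ hx hy
    rw [map_add]
    exact add_mem hx hy
  · intro c x _ hx
    rw [map_smul]
    exact Submodule.smul_mem _ _ hx

variable (A) in
/-- The trivial extension `Δ A = A ⋉ D A`, on the vector space `A ⊕ D A`. -/
def TrivExt : Type _ := A × localDual k A

namespace TrivExt

instance : AddCommGroup (TrivExt k A) := inferInstanceAs (AddCommGroup (A × localDual k A))
instance : Module k (TrivExt k A) := inferInstanceAs (Module k (A × localDual k A))

/-- `(a, x) (b, y) = (a b, a y + x b)`. -/
instance : Mul (TrivExt k A) :=
  ⟨fun p q => (p.1 * q.1,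
    ⟨lAct k p.1 q.2.1 + rAct k q.1 p.2.1,
      add_mem (lAct_mem k _ _ q.2.2) (rAct_mem k _ _ p.2.2)⟩)⟩

variable {k}

lemma ext' {p q : TrivExt k A} (h1 : p.1 = q.1) (h2 : ∀ x, p.2.1 x = q.2.1 x) : p = q :=
  Prod.ext h1 (Subtype.ext (LinearMap.ext h2))

@[simp] lemma fst_mul (p q : TrivExt k A) : (p * q).1 = p.1 * q.1 := rfl
@[simp] lemma snd_mul (p q : TrivExt k A) (x : A) :
    (p * q).2.1 x = q.2.1 (x * p.1) + p.2.1 (q.1 * x) := rfl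
@[simp] lemma fst_add (p q : TrivExt k A) : (p + q).1 = p.1 + q.1 := rfl
@[simp] lemma snd_add (p q : TrivExt k A) (x : A) : (p + q).2.1 x = p.2.1 x + q.2.1 x := rfl
@[simp] lemma fst_zero : (0 : TrivExt k A).1 = 0 := rfl
@[simp] lemma snd_zero (x : A) : (0 : TrivExt k A).2.1 x = 0 := rfl
@[simp] lemma fst_smul (c : k) (p : TrivExt k A) : (c • p).1 = c • p.1 := rfl
@[simp] lemma snd_smul (c : k) (p : TrivExt k A) (x : A) : (c • p).2.1 x = c * p.2.1 x := rfl

instance : NonUnitalRing (TrivExt k A) where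
  left_distrib p q r := ext' (by simp [mul_add]) (fun x => by simp [add_mul]; ring)
  right_distrib p q r := ext' (by simp [add_mul]) (fun x => by simp [mul_add]; ring)
  zero_mul p := ext' (by simp) (fun x => by simp)
  mul_zero p := ext' (by simp) (fun x => by simp)
  mul_assoc p q r := ext' (by simp [mul_assoc]) (fun x => by simp [mul_assoc]; ring)

instance : IsScalarTower k (TrivExt k A) (TrivExt k A) := ⟨fun c p q =>
  ext' (by simp [smul_mul_assoc]) (fun x => by simp [mul_smul_comm]; ring)⟩

instance : SMulCommClass k (TrivExt k A) (TrivExt k A) := ⟨fun c p q =>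
  ext' (by simp [mul_smul_comm]) (fun x => by simp [smul_mul_assoc]; ring)⟩

variable (k A) in
/-- The inclusion `a ↦ (a, 0)`. -/
def inl : A →ₗ[k] TrivExt k A := LinearMap.inl k A (localDual k A)

variable (k A) in
/-- The inclusion `φ ↦ (0, φ)`. -/
def inr : localDual k A →ₗ[k] TrivExt k A := LinearMap.inr k A (localDual k A)

variable (k A) in
/-- The `ℤ`-grading of `Δ A` with `A` in degree `0` and `D A` in degree `1`. -/
def grade (d : ℤ) : Submodule k (TrivExt k A) where
  carrier := {p | (d ≠ 0 → p.1 = 0) ∧ (d ≠ 1 → p.2 = 0)}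
  add_mem' := by
    rintro p q ⟨hp, hp'⟩ ⟨hq, hq'⟩
    refine ⟨fun h => ?_, fun h => ?_⟩
    · rw [fst_add, hp h, hq h, add_zero]
    · change p.2 + q.2 = 0
      rw [hp' h, hq' h, add_zero]
  zero_mem' := ⟨fun _ => rfl, fun _ => rfl⟩
  smul_mem' := by
    rintro c p ⟨hp, hp'⟩
    refine ⟨fun h => ?_, fun h => ?_⟩
    · rw [fst_smul, hp h, smul_zero]
    · change c • p.2 = 0
      rw [hp' h, smul_zero]

lemma mem_grade {d : ℤ} {p : TrivExt k A} :
    p ∈ grade k A d ↔ (d ≠ 0 → p.1 = 0) ∧ (d ≠ 1 → p.2 = 0) := Iff.rfl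

lemma inl_mem (a : A) : inl k A a ∈ grade k A 0 := ⟨fun h => absurd rfl h, fun _ => rfl⟩
lemma inr_mem (φ : localDual k A) : inr k A φ ∈ grade k A 1 :=
  ⟨fun _ => rfl, fun h => absurd rfl h⟩

instance : SetLike.GradedMul (grade k A) := ⟨by
  intro i j p q hp hq
  rw [mem_grade] at hp hq ⊢
  refine ⟨fun h => ?_, fun h => Subtype.ext (LinearMap.ext fun x => ?_)⟩
  · by_cases hi : i = 0
    · have hj : j ≠ 0 := by omega
      simp [hq.1 hj]
    · simp [hp.1 hi]
  · rw [snd_mul]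
    have e1 : q.2.1 (x * p.1) = 0 := by
      by_cases hi : i = 0
      · rw [hq.2 (by omega)]; rfl
      · rw [hp.1 hi, mul_zero, map_zero]
    have e2 : p.2.1 (q.1 * x) = 0 := by
      by_cases hj : j = 0
      · rw [hp.2 (by omega)]; rfl
      · rw [hq.1 hj, zero_mul, map_zero]
    rw [e1, e2, add_zero]; rfl⟩

variable (k A) in
/-- The degree `0` part `(a, φ) ↦ (a, 0)`. -/
def part0 : TrivExt k A →ₗ[k] grade k A 0 where
  toFun p := ⟨inl k A p.1, inl_mem p.1⟩
  map_add' p q := Subtype.ext (ext' rfl fun x => (add_zero (0 : k)).symm)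
  map_smul' c p := Subtype.ext (ext' rfl fun x => (mul_zero c).symm)

variable (k A) in
/-- The degree `1` part `(a, φ) ↦ (0, φ)`. -/
def part1 : TrivExt k A →ₗ[k] grade k A 1 where
  toFun p := ⟨inr k A p.2, inr_mem p.2⟩
  map_add' p q := Subtype.ext (ext' (add_zero (0 : A)).symm fun x => rfl)
  map_smul' c p := Subtype.ext (ext' (smul_zero c).symm fun x => rfl)

lemma part0_add_part1 (p : TrivExt k A) : (part0 k A p : TrivExt k A) + part1 k A p = p :=
  Prod.ext (add_zero p.1) (zero_add p.2)

instance : DirectSum.Decomposition (grade k A) :=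
  DirectSum.Decomposition.ofLinearMap (grade k A)
    ((DirectSum.lof k ℤ (fun d => grade k A d) 0) ∘ₗ part0 k A +
      (DirectSum.lof k ℤ (fun d => grade k A d) 1) ∘ₗ part1 k A)
    (by
      refine LinearMap.ext fun p => ?_
      simp only [LinearMap.comp_apply, LinearMap.add_apply, LinearMap.id_apply, map_add,
        DirectSum.coeLinearMap_lof, part0_add_part1])
    (by
      refine DirectSum.linearMap_ext _ fun d => LinearMap.ext fun p => ?_
      obtain ⟨p, hp⟩ := p
      simp only [LinearMap.comp_apply, LinearMap.add_apply, LinearMap.id_apply,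
        DirectSum.coeLinearMap_lof]
      rw [mem_grade] at hp
      by_cases h0 : d = 0
      · subst h0
        have h2 : p.2 = 0 := hp.2 (by norm_num)
        have e1 : part0 k A p = ⟨p, hp⟩ := Subtype.ext (Prod.ext rfl h2.symm)
        have e2 : part1 k A p = 0 := Subtype.ext (Prod.ext rfl h2)
        rw [e1, e2, map_zero, add_zero]
      · have h1 : p.1 = 0 := hp.1 h0
        have e1 : part0 k A p = 0 := Subtype.ext (Prod.ext h1 rfl)
        by_cases hd : d = 1
        · subst hd
          have e2 : part1 k A p = ⟨p, hp⟩ := Subtype.ext (Prod.ext h1.symm rfl)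
          rw [e1, e2, map_zero, zero_add]
        · have h2 : p.2 = 0 := hp.2 hd
          have e2 : part1 k A p = 0 := Subtype.ext (Prod.ext rfl h2)
          have e3 : (⟨p, hp⟩ : grade k A d) = 0 := Subtype.ext (Prod.ext h1 h2)
          rw [e1, e2, e3, map_zero, map_zero, map_zero, add_zero])

end TrivExt

/-! ### The smash product `A # k ℤ^*` -/

section Smash

variable {k} (𝒜 : ℤ → Submodule k A) [DirectSum.Decomposition 𝒜]

/-- The homogeneous component `a ↦ a_d` of a graded algebra. -/
def component (d : ℤ) : A →ₗ[k] A :=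
  (𝒜 d).subtype ∘ₗ DirectSum.component k ℤ (fun i => 𝒜 i) d ∘ₗ
    (DirectSum.decomposeLinearEquiv 𝒜).toLinearMap

lemma component_of_mem {d e : ℤ} {a : A} (ha : a ∈ 𝒜 e) :
    component 𝒜 d a = if d = e then a else 0 := by
  have : component 𝒜 d a = ((DirectSum.decompose 𝒜 a) d : A) := rfl
  rw [this]
  split_ifs with h
  · subst h
    exact DirectSum.decompose_of_mem_same 𝒜 ha
  · exact DirectSum.decompose_of_mem_ne 𝒜 ha (Ne.symm h)

lemma component_mem (d : ℤ) (a : A) : component 𝒜 d a ∈ 𝒜 d :=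
  ((DirectSum.decompose 𝒜 a) d).2

lemma component_mul_component [SetLike.GradedMul 𝒜] (d e : ℤ) (a b : A) :
    component 𝒜 (d + e) (a * component 𝒜 e b) = component 𝒜 d a * component 𝒜 e b := by
  induction a using DirectSum.Decomposition.inductionOn 𝒜 with
  | zero => simp
  | @homogeneous i a =>
    have h := SetLike.GradedMul.mul_mem a.2 (component_mem 𝒜 e b)
    rw [component_of_mem 𝒜 h, component_of_mem 𝒜 a.2]
    by_cases hd : d = i
    · simp [hd]
    · simp [hd]
  | add a a' h h' => simp only [add_mul, map_add, h, h']

/-- The smash product `A # k ℤ^*` of a `ℤ`-graded algebra with the dual of the group algebra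
`k ℤ`, spanned by orthogonal idempotents `p_t` (`t ∈ ℤ`). Its elements are the finite sums
`∑ a_t p_t` with `a_t ∈ A`, stored as the finitely supported function `t ↦ a_t`. -/
def Smash (_𝒜 : ℤ → Submodule k A) : Type _ := ℤ →₀ A

namespace Smash

instance : AddCommGroup (Smash 𝒜) := inferInstanceAs (AddCommGroup (ℤ →₀ A))
instance : Module k (Smash 𝒜) := inferInstanceAs (Module k (ℤ →₀ A))

/-- The element `a p_t`, linear in `a`. -/
def of (t : ℤ) : A →ₗ[k] Smash 𝒜 := Finsupp.lsingle t

/-- The map `b p_t ↦ a b_{s-t} p_t`, which is left multiplication by `a p_s`. -/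
def mulOf (s : ℤ) (a : A) : Smash 𝒜 →ₗ[k] Smash 𝒜 :=
  Finsupp.lsum (M := A) k fun t => of 𝒜 t ∘ₗ LinearMap.mulLeft k a ∘ₗ component 𝒜 (s - t)

lemma mulOf_of (s t : ℤ) (a b : A) :
    mulOf 𝒜 s a (of 𝒜 t b) = of 𝒜 t (a * component 𝒜 (s - t) b) :=
  Finsupp.lsum_single k _ t b

lemma hom_ext {X : Type*} [AddCommGroup X] [Module k X] {F G : Smash 𝒜 →ₗ[k] X}
    (h : ∀ t a, F (of 𝒜 t a) = G (of 𝒜 t a)) : F = G :=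
  Finsupp.lhom_ext (M := A) h

/-- `a p_s ↦ mulOf s a`, extended linearly. -/
def mulHom : Smash 𝒜 →ₗ[k] Smash 𝒜 →ₗ[k] Smash 𝒜 :=
  Finsupp.lsum (M := A) k fun s =>
    { toFun := mulOf 𝒜 s
      map_add' := fun a b => hom_ext 𝒜 fun t c => by
        simp only [LinearMap.add_apply, mulOf_of, add_mul, map_add]
      map_smul' := fun x a => hom_ext 𝒜 fun t c => by
        simp only [LinearMap.smul_apply, mulOf_of, smul_mul_assoc, map_smul, RingHom.id_apply] }

lemma mulHom_of (s : ℤ) (a : A) : mulHom 𝒜 (of 𝒜 s a) = mulOf 𝒜 s a :=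
  Finsupp.lsum_single k _ s a

/-- `(a p_s) (b p_t) = a b_{s-t} p_t`, extended bilinearly. -/
instance : Mul (Smash 𝒜) := ⟨fun f g => mulHom 𝒜 f g⟩

lemma mul_def (f g : Smash 𝒜) : f * g = mulHom 𝒜 f g := rfl

lemma of_mul_of (s t : ℤ) (a b : A) :
    of 𝒜 s a * of 𝒜 t b = of 𝒜 t (a * component 𝒜 (s - t) b) := by
  rw [mul_def, mulHom_of, mulOf_of]

lemma mul_add' (f g h : Smash 𝒜) : f * (g + h) = f * g + f * h := by
  simp only [mul_def, map_add]

lemma add_mul' (f g h : Smash 𝒜) : (f + g) * h = f * h + g * h := by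
  simp only [mul_def, map_add, LinearMap.add_apply]

lemma zero_mul' (f : Smash 𝒜) : 0 * f = 0 := by
  simp only [mul_def, map_zero, LinearMap.zero_apply]

lemma mul_zero' (f : Smash 𝒜) : f * 0 = 0 := by
  simp only [mul_def, map_zero]

lemma induction {P : Smash 𝒜 → Prop} (f : Smash 𝒜) (h0 : P 0)
    (hadd : ∀ f g, P f → P g → P (f + g)) (hof : ∀ t a, P (of 𝒜 t a)) : P f :=
  Finsupp.induction_linear (motive := P) f h0 hadd hof

variable [SetLike.GradedMul 𝒜]

lemma mul_assoc' (f g h : Smash 𝒜) : f * g * h = f * (g * h) := by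
  induction f using induction with
  | h0 => simp only [zero_mul']
  | hadd f₁ f₂ h₁ h₂ => simp only [add_mul', h₁, h₂]
  | hof r a =>
    induction g using induction with
    | h0 => simp only [zero_mul', mul_zero']
    | hadd f₁ f₂ h₁ h₂ => simp only [add_mul', mul_add', h₁, h₂]
    | hof s b =>
      induction h using induction with
      | h0 => simp only [mul_zero']
      | hadd f₁ f₂ h₁ h₂ => simp only [mul_add', h₁, h₂]
      | hof t c =>
        simp only [of_mul_of]
        rw [← sub_add_sub_cancel r s t, component_mul_component 𝒜, mul_assoc]

instance : NonUnitalRing (Smash 𝒜) where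
  left_distrib := mul_add' 𝒜
  right_distrib := add_mul' 𝒜
  zero_mul := zero_mul' 𝒜
  mul_zero := mul_zero' 𝒜
  mul_assoc := mul_assoc' 𝒜

instance : IsScalarTower k (Smash 𝒜) (Smash 𝒜) := ⟨fun c f g => by
  simp only [smul_eq_mul, mul_def, map_smul, LinearMap.smul_apply]⟩

instance : SMulCommClass k (Smash 𝒜) (Smash 𝒜) := ⟨fun c f g => by
  simp only [smul_eq_mul, mul_def, map_smul]⟩

end Smash

end Smash

end Algebras

/-! ### Self-injective algebras -/

section SelfInjective

variable {k : Type uk} [Field k] {B : Type uB} [NonUnitalRing B] [Module k B] [IsScalarTower k B B]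
  [SMulCommClass k B B]

variable (k B) in
/-- Unital left modules over a `k`-algebra `B`: `B M = M`. -/
structure UMod where
  carrier : Type w
  [grp : AddCommGroup carrier]
  [mod : Module k carrier]
  act : B →ₙₐ[k] Module.End k carrier
  unital : Submodule.span k {y : carrier | ∃ b x, y = act b x} = ⊤

attribute [instance] UMod.grp UMod.mod

/-- `f` is a homomorphism of `B`-modules. -/
def UMod.IsHom (X : UMod.{w} k B) (Y : UMod.{uI} k B)
    (f : X.carrier →ₗ[k] Y.carrier) : Prop :=
  ∀ b x, f (X.act b x) = Y.act b (f x)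

/-- `I` is injective with respect to all unital `B`-modules in the universe `w`: every homomorphism
`X → I` extends along every injective homomorphism `X → Y`. -/
def UMod.IsInjective (I : UMod.{uI} k B) : Prop :=
  ∀ (X Y : UMod.{w} k B) (i : X.carrier →ₗ[k] Y.carrier) (f : X.carrier →ₗ[k] I.carrier),
    UMod.IsHom X Y i → Function.Injective i → UMod.IsHom X I f →
      ∃ g : Y.carrier →ₗ[k] I.carrier, UMod.IsHom Y I g ∧ g ∘ₗ i = f

variable (k) in
/-- The left ideal `B e = {x | x e = x}` of an idempotent `e`. -/
def leftIdeal (e : B) : Submodule k B where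
  carrier := {x | x * e = x}
  add_mem' {x y} hx hy := by
    have hx' : x * e = x := hx
    have hy' : y * e = y := hy
    change (x + y) * e = x + y
    rw [add_mul, hx', hy']
  zero_mem' := zero_mul e
  smul_mem' c x hx := by
    have hx' : x * e = x := hx
    change (c • x) * e = c • x
    rw [smul_mul_assoc, hx']

lemma mem_leftIdeal {e x : B} : x ∈ leftIdeal k e ↔ x * e = x := Iff.rfl

variable (k) in
/-- The projective left module `B e` of an idempotent `e`. -/
def leftProj (e : B) (he : e * e = e) : UMod k B where
  carrier := leftIdeal k e
  act :=
    { toFun := fun b =>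
        { toFun := fun x => ⟨b * x.1, by rw [mem_leftIdeal, mul_assoc, mem_leftIdeal.1 x.2]⟩
          map_add' := fun x y => Subtype.ext (mul_add b x.1 y.1)
          map_smul' := fun c x => Subtype.ext (mul_smul_comm c b x.1) }
      map_smul' := fun c b => LinearMap.ext fun x => Subtype.ext (smul_mul_assoc c b x.1)
      map_zero' := LinearMap.ext fun x => Subtype.ext (zero_mul x.1)
      map_add' := fun b c => LinearMap.ext fun x => Subtype.ext (add_mul b c x.1)
      map_mul' := fun b c => LinearMap.ext fun x => Subtype.ext (mul_assoc b c x.1) }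
  unital := by
    refine eq_top_iff.2 fun x _ => Submodule.subset_span ⟨x.1, ⟨e, he⟩, ?_⟩
    exact Subtype.ext (mem_leftIdeal.1 x.2).symm

variable (k B) in
/-- `B` is left self-injective: for every idempotent `e`, the projective module `B e` is injective
among unital left modules. If `B` has an identity, this says that `B` is an injective left
module over itself. -/
def IsLeftSelfInjective : Prop :=
  ∀ (e : B) (he : e * e = e), UMod.IsInjective.{w} (leftProj k e he)

variable (k B) in
/-- `B` is a self-injective algebra: it has local identities, and it is injective over itself on
the left and on the right (right `B`-modules being left modules over the opposite algebra). -/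
def IsSelfInjective : Prop :=
  (∀ s : Finset B, ∃ e : B, e * e = e ∧ ∀ b ∈ s, e * b = b ∧ b * e = b) ∧
    IsLeftSelfInjective.{w} k B ∧ IsLeftSelfInjective.{w} k Bᵐᵒᵖ

end SelfInjective

/-! ### Path algebras and bound quivers -/

section Paths

variable (k : Type*) [Field k] (V : Type u) [Quiver.{v} V]

/-- The paths of a quiver, of length `≥ 0`, with their starting and ending vertices. -/
structure QPath where
  src : V
  tgt : V
  path : Quiver.Path src tgt

variable {V}

/-- The length of a path. -/
def QPath.length (q : QPath V) : ℕ := q.path.length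

/-- The trivial path at a vertex. -/
def QPath.nil (i : V) : QPath V := ⟨i, i, Quiver.Path.nil⟩

/-- An arrow as a path of length one. -/
def QPath.arrow {i j : V} (α : i ⟶ j) : QPath V := ⟨i, j, α.toPath⟩

/-- The path `q p`: first `p`, then `q`. -/
def QPath.comp (q p : QPath V) (h : p.tgt = q.src) : QPath V :=
  ⟨p.src, q.tgt, p.path.comp (q.path.cast h.symm rfl)⟩

lemma QPath.length_comp (q p : QPath V) (h : p.tgt = q.src) :
    (q.comp p h).length = q.length + p.length := by
  obtain ⟨a, b, p⟩ := p
  obtain ⟨c, d, q⟩ := q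
  cases h
  simp [QPath.comp, QPath.length, add_comm]

variable (V) in
/-- The path algebra `k Q`, with the paths as a basis. -/
def PathAlg : Type _ := QPath V →₀ k

namespace PathAlg

instance : AddCommGroup (PathAlg k V) := inferInstanceAs (AddCommGroup (QPath V →₀ k))
instance : Module k (PathAlg k V) := inferInstanceAs (Module k (QPath V →₀ k))

/-- A path as an element of the path algebra. -/
def of (q : QPath V) : PathAlg k V := Finsupp.single q 1

variable {k} in
/-- The linear map on `k Q` with prescribed values on the paths. -/
def lift {X : Type*} [AddCommGroup X] [Module k X] (f : QPath V → X) : PathAlg k V →ₗ[k] X :=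
  Finsupp.linearCombination k f

lemma lift_of {X : Type*} [AddCommGroup X] [Module k X] (f : QPath V → X) (q : QPath V) :
    lift f (of k q) = f q := by
  exact (Finsupp.linearCombination_single k 1 q).trans (one_smul k (f q))

variable {k} in
lemma hom_ext {X : Type*} [AddCommGroup X] [Module k X] {F G : PathAlg k V →ₗ[k] X}
    (h : ∀ q, F (of k q) = G (of k q)) : F = G :=
  Finsupp.lhom_ext' (M := k) fun q => LinearMap.ext_ring (h q)

variable {k} in
lemma induction {P : PathAlg k V → Prop} (f : PathAlg k V) (h0 : P 0)
    (hadd : ∀ f g, P f → P g → P (f + g)) (hof : ∀ (c : k) q, P (c • of k q)) : P f :=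
  Finsupp.induction_linear (motive := P) f h0 hadd fun q c => by
    have h : (Finsupp.single q c : QPath V →₀ k) = c • Finsupp.single q 1 := by simp
    rw [h]
    exact hof c q

/-- The product of two paths: `q p` if `p` ends where `q` starts, and `0` otherwise. -/
def mulPath (q p : QPath V) : PathAlg k V := if h : p.tgt = q.src then of k (q.comp p h) else 0

/-- The multiplication of the path algebra, extended bilinearly from the paths. -/
def mulHom : PathAlg k V →ₗ[k] PathAlg k V →ₗ[k] PathAlg k V :=
  lift fun q => lift fun p => mulPath k q p

instance : Mul (PathAlg k V) := ⟨fun f g => mulHom k f g⟩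

lemma mul_def (f g : PathAlg k V) : f * g = mulHom k f g := rfl

lemma of_mul_of (q p : QPath V) : of k q * of k p = mulPath k q p := by
  simp only [mul_def, mulHom, lift_of]

lemma mul_assoc' (f g h : PathAlg k V) : f * g * h = f * (g * h) := by
  simp only [mul_def]
  induction f using induction with
  | h0 => simp
  | hadd f₁ f₂ h₁ h₂ => simp only [map_add, LinearMap.add_apply, h₁, h₂]
  | hof c r =>
    induction g using induction with
    | h0 => simp
    | hadd f₁ f₂ h₁ h₂ => simp only [map_add, LinearMap.add_apply, h₁, h₂]
    | hof d q =>
      induction h using induction with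
      | h0 => simp
      | hadd f₁ f₂ h₁ h₂ => simp only [map_add, h₁, h₂]
      | hof e p =>
        simp only [map_smul, LinearMap.smul_apply]
        congr 3
        simp only [← mul_def, of_mul_of]
        have z1 : ∀ x : PathAlg k V, x * 0 = 0 := fun x => by simp only [mul_def, map_zero]
        have z2 : ∀ x : PathAlg k V, 0 * x = 0 := fun x => by
          simp only [mul_def, map_zero, LinearMap.zero_apply]
        obtain ⟨a, b, p⟩ := p
        obtain ⟨b', c', q⟩ := q
        obtain ⟨c'', d', r⟩ := r
        by_cases h1 : b = b'
        · subst h1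
          by_cases h2 : c' = c''
          · subst h2
            simp [mulPath, of_mul_of, QPath.comp]
          · simp [mulPath, of_mul_of, QPath.comp, h2, z2]
        · by_cases h2 : c' = c''
          · subst h2
            simp [mulPath, of_mul_of, QPath.comp, h1, z1]
          · simp [mulPath, h1, h2, z1, z2]

instance : NonUnitalRing (PathAlg k V) where
  left_distrib f g h := by simp only [mul_def, map_add]
  right_distrib f g h := by simp only [mul_def, map_add, LinearMap.add_apply]
  zero_mul f := by simp only [mul_def, map_zero, LinearMap.zero_apply]
  mul_zero f := by simp only [mul_def, map_zero]
  mul_assoc := mul_assoc' k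

instance : IsScalarTower k (PathAlg k V) (PathAlg k V) := ⟨fun c f g => by
  simp only [smul_eq_mul, mul_def, map_smul, LinearMap.smul_apply]⟩

instance : SMulCommClass k (PathAlg k V) (PathAlg k V) := ⟨fun c f g => by
  simp only [smul_eq_mul, mul_def, map_smul]⟩

/-- The linear combinations of the paths in a set `S`. -/
def supp (S : Set (QPath V)) : Submodule k (PathAlg k V) := Submodule.span k (of k '' S)

/-- The component of an element of the path algebra in the span of the paths of length `n`. -/
def proj (n : ℕ) : PathAlg k V →ₗ[k] PathAlg k V :=
  lift fun q => if q.length = n then of k q else 0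

lemma proj_of (n : ℕ) (q : QPath V) :
    proj k n (of k q) = if q.length = n then of k q else 0 := by simp only [proj, lift_of]

lemma proj_of_mul (n : ℕ) (q : QPath V) (x : PathAlg k V) :
    proj k n (of k q * x) = if q.length ≤ n then of k q * proj k (n - q.length) x else 0 := by
  induction x using induction with
  | h0 => simp
  | hadd f g hf hg => rw [mul_add, map_add, hf, hg]; split_ifs <;> simp [mul_add]
  | hof c p =>
    rw [mul_smul_comm, map_smul, map_smul, of_mul_of, proj_of, mulPath]
    by_cases h : p.tgt = q.src
    · rw [dif_pos h, proj_of, QPath.length_comp]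
      by_cases h1 : q.length ≤ n
      · by_cases h2 : p.length = n - q.length
        · rw [if_pos (by omega), if_pos h1, if_pos h2, mul_smul_comm, of_mul_of, mulPath, dif_pos h]
        · rw [if_neg (by omega), if_pos h1, if_neg h2]; simp
      · rw [if_neg (by omega), if_neg h1, smul_zero]
    · rw [dif_neg h]
      split_ifs
      · simp [mul_smul_comm, of_mul_of, mulPath, h]
      · simp
      · simp

lemma proj_mul_of (n : ℕ) (q : QPath V) (x : PathAlg k V) :
    proj k n (x * of k q) = if q.length ≤ n then proj k (n - q.length) x * of k q else 0 := by
  induction x using induction with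
  | h0 => simp
  | hadd f g hf hg => rw [add_mul, map_add, hf, hg]; split_ifs <;> simp [add_mul]
  | hof c p =>
    rw [smul_mul_assoc, map_smul, map_smul, of_mul_of, proj_of, mulPath]
    by_cases h : q.tgt = p.src
    · rw [dif_pos h, proj_of, QPath.length_comp]
      by_cases h1 : q.length ≤ n
      · by_cases h2 : p.length = n - q.length
        · rw [if_pos (by omega), if_pos h1, if_pos h2, smul_mul_assoc, of_mul_of, mulPath, dif_pos h]
        · rw [if_neg (by omega), if_pos h1, if_neg h2]; simp
      · rw [if_neg (by omega), if_neg h1, smul_zero]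
    · rw [dif_neg h]
      split_ifs
      · simp [smul_mul_assoc, of_mul_of, mulPath, h]
      · simp
      · simp

lemma proj_of_mem_supp (n m : ℕ) (S : Set (QPath V)) (hS : ∀ q ∈ S, q.length = m)
    (x : PathAlg k V) (hx : x ∈ supp k S) : proj k n x = if m = n then x else 0 := by
  refine Submodule.span_induction
    (p := fun x _ => proj k n x = if m = n then x else 0) ?_ ?_ ?_ ?_ hx
  · rintro _ ⟨q, hq, rfl⟩
    rw [proj_of, hS q hq]
  · simp
  · intro x y _ _ hx hy
    rw [map_add, hx, hy]; split_ifs <;> simp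
  · intro c x _ hx
    rw [map_smul, hx]; split_ifs <;> simp

end PathAlg

variable (V) in
/-- A bound quiver: a quiver with a set of relations, each a linear combination of paths of the
same length `≥ 2` with the same starting vertex and the same ending vertex. -/
structure BoundQuiver where
  rel : Set (PathAlg k V)
  homogeneous : ∀ x ∈ rel, ∃ (i j : V) (m : ℕ), 2 ≤ m ∧
    x ∈ PathAlg.supp k {q : QPath V | q.src = i ∧ q.tgt = j ∧ q.length = m}

namespace BoundQuiver

variable {k} (Q : BoundQuiver k V)

/-- The bound quiver algebra `Λ = k Q / (ρ)`. -/
abbrev Alg : Type _ := AlgQuot k Q.rel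

/-- The image of a path in `Λ`. -/
def path (q : QPath V) : Q.Alg := AlgQuot.mk k Q.rel (PathAlg.of k q)

/-- The idempotent `e_i` of `Λ`. -/
def vertex (i : V) : Q.Alg := Q.path (QPath.nil i)

/-- The image of an arrow in `Λ`. -/
def arrow {i j : V} (α : i ⟶ j) : Q.Alg := Q.path (QPath.arrow α)

lemma proj_mem (n : ℕ) (x : PathAlg k V) (hx : x ∈ idealSpan k Q.rel) :
    PathAlg.proj k n x ∈ idealSpan k Q.rel := by
  have key : idealSpan k Q.rel ≤
      ⨅ n : ℕ, (idealSpan k Q.rel).comap (PathAlg.proj (V := V) k n) := by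
    refine idealSpan_le k _ _ ?_ ?_
    · intro x hx
      simp only [SetLike.mem_coe, Submodule.mem_iInf, Submodule.mem_comap]
      intro n
      obtain ⟨i, j, m, -, hm⟩ := Q.homogeneous x hx
      rw [PathAlg.proj_of_mem_supp k n m _ (fun q hq => hq.2.2) x hm]
      split_ifs
      · exact subset_idealSpan k _ hx
      · exact zero_mem _
    · intro a x hx
      simp only [Submodule.mem_iInf, Submodule.mem_comap] at hx ⊢
      induction a using PathAlg.induction with
      | h0 => simp
      | hadd f g hf hg =>
        refine ⟨fun n => ?_, fun n => ?_⟩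
        · rw [add_mul, map_add]; exact add_mem (hf.1 n) (hg.1 n)
        · rw [mul_add, map_add]; exact add_mem (hf.2 n) (hg.2 n)
      | hof c q =>
        refine ⟨fun n => ?_, fun n => ?_⟩
        · rw [smul_mul_assoc, map_smul, PathAlg.proj_of_mul]
          refine Submodule.smul_mem _ _ ?_
          split_ifs
          · exact (idealSpan_mul_mem k _ _ _ (hx _)).1
          · exact zero_mem _
        · rw [mul_smul_comm, map_smul, PathAlg.proj_mul_of]
          refine Submodule.smul_mem _ _ ?_
          split_ifs
          · exact (idealSpan_mul_mem k _ _ _ (hx _)).2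
          · exact zero_mem _
  have := key hx
  simp only [Submodule.mem_iInf, Submodule.mem_comap] at this
  exact this n

/-- The projection of the graded algebra `Λ = Λ_0 + Λ_1 + ⋯` onto `Λ_n`, the span of the images of
the paths of length `n`. -/
def proj (n : ℕ) : Q.Alg →ₗ[k] Q.Alg :=
  Submodule.mapQ (idealSpan k Q.rel) (idealSpan k Q.rel) (PathAlg.proj k n) (Q.proj_mem n)

lemma proj_path (n : ℕ) (q : QPath V) :
    Q.proj n (Q.path q) = if q.length = n then Q.path q else 0 := by
  have : Q.proj n (Q.path q) = AlgQuot.mk k Q.rel (PathAlg.proj k n (PathAlg.of k q)) := rfl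
  rw [this, PathAlg.proj_of]
  split_ifs
  · rfl
  · exact map_zero _

/-- The block `e_j Λ e_i`, spanned by the images of the paths from `i` to `j`. -/
def block (i j : V) : Submodule k Q.Alg :=
  Submodule.span k (Q.path '' {q | q.src = i ∧ q.tgt = j})

/-- The quiver has no oriented cycles. -/
def IsAcyclic (_Q : BoundQuiver k V) : Prop := ∀ (i : V) (p : Quiver.Path i i), p.length = 0

/-- A path is a bound path if its image in `Λ` is nonzero. -/
def IsBoundPath (p : QPath V) : Prop := Q.path p ≠ 0

/-- A bound path `p` is maximal if no bound path `u p v` is longer than `p`. -/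
def IsMaximalBoundPath (p : QPath V) : Prop :=
  Q.IsBoundPath p ∧
    ∀ u v : QPath V, Q.path u * Q.path p * Q.path v ≠ 0 → u.length = 0 ∧ v.length = 0

/-- All maximal bound paths have the same length `n`, and no bound path is longer than `n`, so
that `Λ = Λ_0 + ⋯ + Λ_n` and every bound path lies in a maximal one. (The second condition follows
from the first when the quiver is finite and acyclic.) -/
def IsHomogeneous (n : ℕ) : Prop :=
  (∀ p, Q.IsMaximalBoundPath p → p.length = n) ∧ ∀ p, Q.IsBoundPath p → p.length ≤ n

/-- `M` is a maximal linearly independent set of maximal bound paths. -/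
structure IsMaximalIndep (M : Set (QPath V)) : Prop where
  maximal : ∀ p ∈ M, Q.IsMaximalBoundPath p
  indep : LinearIndepOn k Q.path M
  span : ∀ p, Q.IsMaximalBoundPath p → Q.path p ∈ Submodule.span k (Q.path '' M)

variable {Q} {M : Set (QPath V)} (hM : Q.IsMaximalIndep M)

/-- A functional on `Λ` extending the coordinate functional of `p ∈ M` on the span of `M`. -/
def coord (p : M) : Q.Alg →ₗ[k] k :=
  (LinearMap.exists_extend
    (Finsupp.lapply p ∘ₗ hM.indep.linearIndependent.repr)).choose

lemma coord_path (p q : M) : coord hM p (Q.path q) = if p = q then 1 else 0 := by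
  have h := (LinearMap.exists_extend
    (Finsupp.lapply p ∘ₗ hM.indep.linearIndependent.repr)).choose_spec
  have hq : Q.path q ∈ Submodule.span k (Set.range fun x : M => Q.path x) :=
    Submodule.subset_span ⟨q, rfl⟩
  have h1 := LinearMap.congr_fun h ⟨Q.path q, hq⟩
  have h2 : hM.indep.linearIndependent.repr ⟨Q.path q, hq⟩ = Finsupp.single q 1 :=
    hM.indep.linearIndependent.repr_eq_single q _ rfl
  have h3 : coord hM p (Q.path q) =
      hM.indep.linearIndependent.repr ⟨Q.path q, hq⟩ p := h1
  rw [h3, h2, Finsupp.single_apply]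
  simp only [eq_comm]

/-- The element `p^*` of the basis of `D Λ_n` dual to `M`, as a functional on `Λ` that vanishes on
`Λ_t` for `t ≠ n` (here `n` is the length of `p`) and on all blocks `e_j Λ e_i` other than that
of `p`. -/
def dual (p : M) : localDual k Q.Alg :=
  ⟨biAct k (Q.vertex p.1.src) (Q.vertex p.1.tgt) (coord hM p ∘ₗ Q.proj p.1.length),
    biAct_mem k _ _ _⟩

end BoundQuiver

/-! ### The returning arrow quiver and the quiver `ℤ|_{n-1} Q` -/

variable {k}

/-- The vertices of the returning arrow quiver: those of `Q`. -/
def Ret (_M : Set (QPath V)) : Type u := V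

/-- The arrows of the returning arrow quiver: the arrows of `Q`, and an arrow
`β_p : t(p) → s(p)` for each `p` in `M`. -/
inductive RetHom (M : Set (QPath V)) : V → V → Type (max u v)
  | arrow {i j : V} (α : i ⟶ j) : RetHom M i j
  | ret (p : M) : RetHom M p.1.tgt p.1.src

instance (M : Set (QPath V)) : Quiver (Ret M) := ⟨fun i j => RetHom (V := V) M i j⟩

/-- The vertices `(i, t)`, `i ∈ Q_0`, `t ∈ ℤ`, of `ℤ|_{n-1} Q`. -/
structure ZVert (M : Set (QPath V)) where
  base : V
  level : ℤ

/-- The arrows of `ℤ|_{n-1} Q`: `(α, t) : (i, t) → (j, t)` for an arrow `α : i → j` of `Q`, and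
`(β_p, t) : (t(p), t) → (s(p), t + 1)` for `p` in `M`. -/
inductive ZHom (M : Set (QPath V)) : ZVert M → ZVert M → Type (max u v)
  | arrow (t : ℤ) {i j : V} (α : i ⟶ j) : ZHom M ⟨i, t⟩ ⟨j, t⟩
  | ret (t : ℤ) (p : M) : ZHom M ⟨p.1.tgt, t⟩ ⟨p.1.src, t + 1⟩

instance (M : Set (QPath V)) : Quiver (ZVert M) := ⟨fun x y => ZHom M x y⟩

variable {M : Set (QPath V)}

/-- `0` for an arrow of `Q`, and `1` for a returning arrow. -/
def retDeg {i j : Ret M} : (i ⟶ j) → ℕ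
  | .arrow _ => 0
  | .ret _ => 1

/-- The number of returning arrows in a path of the returning arrow quiver. -/
def retCountAux {i : Ret M} : {j : Ret M} → Quiver.Path i j → ℕ
  | _, .nil => 0
  | _, .cons p a => retCountAux p + retDeg a

/-- The number of returning arrows in a path of the returning arrow quiver. -/
def retCount (q : QPath (Ret M)) : ℕ := retCountAux q.path

/-- The lift to `ℤ|_{n-1} Q` of an arrow of the returning arrow quiver, starting on level `s`,
together with the level on which it ends: `α` lifts to `(α, s)`, and `β_p` lifts to `(β_p, s)`. -/
def liftHom (s : ℤ) {i j : Ret M} : (i ⟶ j) →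
    (s' : ℤ) × ((⟨i, s⟩ : ZVert M) ⟶ (⟨j, s'⟩ : ZVert M))
  | .arrow α => ⟨s, .arrow s α⟩
  | .ret p => ⟨s + 1, .ret s p⟩

/-- The lift to `ℤ|_{n-1} Q` of a path of the returning arrow quiver, starting on level `t`,
together with the level on which it ends. -/
def liftAux (t : ℤ) {i : Ret M} : {j : Ret M} → Quiver.Path i j →
    (s : ℤ) × Quiver.Path (⟨i, t⟩ : ZVert M) ⟨j, s⟩
  | _, .nil => ⟨t, .nil⟩
  | _, .cons p a =>
    ⟨(liftHom (liftAux t p).1 a).1, (liftAux t p).2.cons (liftHom (liftAux t p).1 a).2⟩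

/-- The lift of a path of the returning arrow quiver that starts on level `t`. -/
def liftPath (t : ℤ) (q : QPath (Ret M)) : QPath (ZVert M) :=
  ⟨⟨q.src, t⟩, ⟨q.tgt, (liftAux t q.path).1⟩, (liftAux t q.path).2⟩

lemma liftHom_level (s : ℤ) {i j : Ret M} : (a : i ⟶ j) → (liftHom s a).1 = s + retDeg a
  | .arrow _ => (add_zero s).symm
  | .ret _ => rfl

lemma liftAux_length (t : ℤ) {i j : Ret M} (p : Quiver.Path i j) :
    (liftAux t p).2.length = p.length := by
  induction p with
  | nil => rfl
  | cons p a ih => simp only [liftAux, Quiver.Path.length_cons, ih]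

lemma liftAux_level (t : ℤ) {i j : Ret M} (p : Quiver.Path i j) :
    (liftAux t p).1 = t + retCountAux p := by
  induction p with
  | nil => exact (add_zero t).symm
  | cons p a ih =>
    simp only [liftAux, retCountAux, liftHom_level, ih]
    push_cast
    ring

/-- The lift of a linear combination of paths that starts on level `t`. -/
def liftElem (t : ℤ) : PathAlg k (Ret M) →ₗ[k] PathAlg k (ZVert M) :=
  PathAlg.lift fun q => PathAlg.of k (liftPath t q)

/-- The linear combinations of paths of length `2` in the returning arrow quiver with exactly `d`
returning arrows, that is, `V ⊗ V` for `d = 0`, `V ⊗ V_M + V_M ⊗ V` for `d = 1` and `V_M ⊗ V_M`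
for `d = 2`. -/
def quadPart (k : Type*) [Field k] (M : Set (QPath V)) (d : ℕ) : Submodule k (PathAlg k (Ret M)) :=
  PathAlg.supp k {q | q.length = 2 ∧ retCount q = d}

namespace BoundQuiver

variable {Q : BoundQuiver k V} (hM : Q.IsMaximalIndep M)

/-- The value in `Δ Λ` of an arrow of the returning arrow quiver: `α ↦ (α, 0)`,
`β_p ↦ (0, p^*)`. -/
def retValue {i j : Ret M} : (i ⟶ j) → TrivExt k Q.Alg
  | .arrow α => TrivExt.inl k Q.Alg (Q.arrow α)
  | .ret p => TrivExt.inr k Q.Alg (dual hM p)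

/-- The value in `Δ Λ` of a path of the returning arrow quiver. -/
def pathValue {i : Ret M} : {j : Ret M} → Quiver.Path i j → TrivExt k Q.Alg
  | _, .nil => TrivExt.inl k Q.Alg (Q.vertex i)
  | _, .cons p a => retValue hM a * pathValue p

/-- The map `μ` from the path algebra of the returning arrow quiver to `Δ Λ`. -/
def mu : PathAlg k (Ret M) →ₗ[k] TrivExt k Q.Alg := PathAlg.lift fun q => pathValue hM q.path

/-- `Δ Λ` is quadratic: with respect to the grading whose degree `0` part is `Λ_0` and whose
degree `1` part is `Λ_1 + D Λ_n`, it is generated in degrees `0` and `1`, that is, by the vertices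
and arrows of the returning arrow quiver, and all relations follow from those of degree `2`. -/
def IsQuadraticTrivExt : Prop :=
  Function.Surjective (mu hM) ∧
    LinearMap.ker (mu hM) =
      idealSpan k {x | x ∈ LinearMap.ker (mu hM) ∧
        x ∈ PathAlg.supp k {q : QPath (Ret M) | q.length = 2}}

/-- A choice of the relations `ρ`, spanning the kernel of `μ` on `V ⊗ V`, and `ρ_0`, spanning the
kernel of `μ` on `V ⊗ V_M + V_M ⊗ V`, each normalized to consist of linear combinations of paths
with the same starting vertex and the same ending vertex. -/
structure QuadRel where
  rho : Set (PathAlg k (Ret M))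
  rho0 : Set (PathAlg k (Ret M))
  span_rho : Submodule.span k rho = LinearMap.ker (mu hM) ⊓ quadPart k M 0
  span_rho0 : Submodule.span k rho0 = LinearMap.ker (mu hM) ⊓ quadPart k M 1
  uniform_rho : ∀ x ∈ rho, ∃ i j : Ret M, x ∈ PathAlg.supp k
    {q : QPath (Ret M) | q.src = i ∧ q.tgt = j ∧ q.length = 2 ∧ retCount q = 0}
  uniform_rho0 : ∀ x ∈ rho0, ∃ i j : Ret M, x ∈ PathAlg.supp k
    {q : QPath (Ret M) | q.src = i ∧ q.tgt = j ∧ q.length = 2 ∧ retCount q = 1}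

/-- The relations `ρ_M`: all paths `β_{p'} β_p`. -/
def rhoM (k : Type*) [Field k] (M : Set (QPath V)) : Set (PathAlg k (Ret M)) :=
  PathAlg.of k '' {q | q.length = 2 ∧ retCount q = 2}

lemma liftElem_mem (t : ℤ) (i j : Ret M) (d : ℕ) (x : PathAlg k (Ret M))
    (hx : x ∈ PathAlg.supp k
      {q : QPath (Ret M) | q.src = i ∧ q.tgt = j ∧ q.length = 2 ∧ retCount q = d}) :
    liftElem t x ∈ PathAlg.supp k
      {q : QPath (ZVert M) | q.src = ⟨i, t⟩ ∧ q.tgt = ⟨j, t + d⟩ ∧ q.length = 2} := by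
  refine Submodule.span_induction (p := fun x _ => liftElem t x ∈ PathAlg.supp k
      {q : QPath (ZVert M) | q.src = ⟨i, t⟩ ∧ q.tgt = ⟨j, t + d⟩ ∧ q.length = 2}) ?_ ?_ ?_ ?_ hx
  · rintro _ ⟨q, ⟨rfl, rfl, h2, rfl⟩, rfl⟩
    refine Submodule.subset_span ⟨liftPath t q, ⟨rfl, ?_, ?_⟩, ?_⟩
    · simp only [liftPath, liftAux_level, retCount]
    · exact (liftAux_length t q.path).trans h2
    · simp only [liftElem, PathAlg.lift_of]
  · simp
  · intro x y _ _ hx hy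
    rw [map_add]; exact add_mem hx hy
  · intro c x _ hx
    rw [map_smul]; exact Submodule.smul_mem _ _ hx

variable {hM} in
/-- The bound quiver `ℤ|_{n-1} Q`, with relations `ℤ ρ ∪ ℤ ρ_M ∪ ℤ ρ_0`. -/
def ZQuiver (R : QuadRel hM) : BoundQuiver k (ZVert M) where
  rel := {y | ∃ t : ℤ, ∃ x ∈ R.rho ∪ rhoM k M ∪ R.rho0, y = liftElem t x}
  homogeneous := by
    rintro _ ⟨t, x, hx, rfl⟩
    have : ∃ (i j : Ret M) (d : ℕ), x ∈ PathAlg.supp k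
        {q : QPath (Ret M) | q.src = i ∧ q.tgt = j ∧ q.length = 2 ∧ retCount q = d} := by
      rcases hx with (hx | ⟨q, ⟨h2, hd⟩, rfl⟩) | hx
      · obtain ⟨i, j, h⟩ := R.uniform_rho x hx
        exact ⟨i, j, 0, h⟩
      · exact ⟨q.src, q.tgt, 2, Submodule.subset_span ⟨q, ⟨rfl, rfl, h2, hd⟩, rfl⟩⟩
      · obtain ⟨i, j, h⟩ := R.uniform_rho0 x hx
        exact ⟨i, j, 1, h⟩
    obtain ⟨i, j, d, h⟩ := this
    exact ⟨⟨i, t⟩, ⟨j, t + d⟩, 2, le_rfl, liftElem_mem t i j d x h⟩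

variable (Q) in
/-- The smash product `Δ Λ # k ℤ^*`, for the grading of `Δ Λ` with `Λ` in degree `0` and the
generators `p^*`, hence all of `D Λ`, in degree `1`. -/
abbrev SmashAlg : Type _ := Smash (TrivExt.grade k Q.Alg)

end BoundQuiver

end Paths

end QuiverAlg

end

noncomputable section

namespace QuiverAlg

open scoped Classical

/-! ### A criterion for self-injectivity -/

section Criterion

variable {k : Type uk} [Field k] {B : Type uB} [NonUnitalRing B] [Module k B] [IsScalarTower k B B]
  [SMulCommClass k B B]

/-! Self-injectivity comes from a Frobenius form. The trivial extension `ΔΛ` is a symmetric algebra: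
the pairing of `(a, φ)` and `(b, ψ)` is `ψ a + φ b`, the `DΛ`-part of the product evaluated at the
(local) identity of `Λ`. Summed over the levels, this evaluation becomes `smashTrace` on the smash
product. As `DΛ` has degree 1, exchanging two factors moves one of them up by a level, so the form
is symmetric only up to the Nakayama automorphism `Smash.shift` (`smashTrace_mul_comm`). It is
nondegenerate and, the blocks being finite dimensional, it represents every functional cut down by
vertex idempotents on both sides (`exists_repr_vertex`). With such a form each `B e` behaves like
the dual of a projective right module, and extending a homomorphism into it amounts to extending a
linear functional (`isLeftSelfInjective_of_form`).

For the presentation, `ℤ|_{n-1} Q` is a covering of the returning arrow quiver: a path upstairs is a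
path downstairs together with a starting level. So every element upstairs is a sum of lifts
`liftElem t x`, and `smashMap` sends such a lift to `μ(x) p_t`; its kernel consists of the sums of
lifts of elements of `ker μ`. Quadraticity generates `ker μ` in length 2. The number of returning
arrows is the degree in `ΔΛ`, so a quadratic relation splits into parts with 0, 1 and 2 returning
arrows, the last being unrestricted because `DΛ · DΛ = 0`. These parts are spanned by `ρ'`, `ρ_0`
and `ρ_M`, whose lifts are the chosen relations (`ker_smashMap`). -/

/-- A nondegenerate functional `tr` on `B` that represents all two-sided local functionals, and
for which right multiplications are adjoint to left multiplications, makes `B` left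
self-injective. -/
theorem isLeftSelfInjective_of_form (tr : B →ₗ[k] k)
    (hnd : ∀ u, (∀ b, tr (b * u) = 0) → u = 0)
    (hrep : ∀ (g : B →ₗ[k] k) (c d : B), ∃ u, ∀ b, g (c * b * d) = tr (b * u))
    (hnak : ∀ e : B, ∃ ε : B, ∀ u, tr (u * e) = tr (ε * u)) :
    IsLeftSelfInjective.{w} k B := by
  intro e he X Y i f hi hinj hf
  obtain ⟨r, hr⟩ := LinearMap.exists_leftInverse_of_injective i (LinearMap.ker_eq_bot.2 hinj)
  have hr' : ∀ x, r (i x) = x := fun x => LinearMap.congr_fun hr x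
  obtain ⟨ε, hε⟩ := hnak e
  -- The retraction `r` is only `k`-linear. After composition with `tr` just a functional has to be
  -- extended, and this suffices.
  let G : Y.carrier →ₗ[k] k := tr ∘ₗ (leftIdeal k e).subtype ∘ₗ f ∘ₗ r
  have hG : ∀ x, G (i x) = tr (f x).1 := fun x => by
    change tr (f (r (i x))).1 = _
    rw [hr']
  have hmul : ∀ (b c : B) (y : Y.carrier), Y.act (b * c) y = Y.act b (Y.act c y) :=
    fun b c y => by rw [map_mul]; rfl
  have huniq : ∀ u u' : B, (∀ b, tr (b * u) = tr (b * u')) → u = u' := fun u u' h =>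
    sub_eq_zero.1 (hnd _ fun b => by rw [mul_sub, map_sub, h b, sub_self])
  -- The factor `ε` bounds the functional on the left, and unitality (`y` is a sum of elements `d
  -- x`) bounds it on the right, so `hrep` applies.
  have hex : ∀ y : Y.carrier, ∃ u : B, ∀ b, G (Y.act (ε * b) y) = tr (b * u) := by
    intro y
    have hy : y ∈ Submodule.span k {y : Y.carrier | ∃ b x, y = Y.act b x} := by
      rw [Y.unital]; trivial
    induction hy using Submodule.span_induction with
    | mem y hy =>
      obtain ⟨d, x, rfl⟩ := hy
      obtain ⟨u, hu⟩ := hrep (G ∘ₗ (LinearMap.applyₗ x) ∘ₗ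
        { toFun := Y.act, map_add' := map_add Y.act, map_smul' := map_smul Y.act }) ε d
      exact ⟨u, fun b => by rw [← hu, ← hmul]; rfl⟩
    | zero => exact ⟨0, fun b => by simp⟩
    | add y z _ _ hy hz =>
      obtain ⟨u, hu⟩ := hy
      obtain ⟨u', hu'⟩ := hz
      exact ⟨u + u', fun b => by rw [map_add, map_add, hu, hu', mul_add, map_add]⟩
    | smul c y _ hy =>
      obtain ⟨u, hu⟩ := hy
      exact ⟨c • u, fun b => by rw [map_smul, map_smul, hu, mul_smul_comm, map_smul]⟩
  choose U hU using hex
  refine ⟨{ toFun := fun y => ⟨U y * e, by rw [mem_leftIdeal, mul_assoc, he]⟩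
            map_add' := fun y z => Subtype.ext ?_
            map_smul' := fun c y => Subtype.ext ?_ }, fun b y => Subtype.ext ?_,
    LinearMap.ext fun x => Subtype.ext ?_⟩
  · change U (y + z) * e = U y * e + U z * e
    rw [← add_mul, huniq (U (y + z)) (U y + U z) fun b => by
      rw [← hU, map_add, map_add, hU, hU, mul_add, map_add]]
  · change U (c • y) * e = c • (U y * e)
    rw [← smul_mul_assoc, huniq (U (c • y)) (c • U y) fun b => by
      rw [← hU, map_smul, map_smul, hU, mul_smul_comm, map_smul]]
  · change U (Y.act b y) * e = b * (U y * e)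
    rw [← mul_assoc, huniq (U (Y.act b y)) (b * U y) fun c => by
      rw [← hU, ← hmul, mul_assoc, hU, mul_assoc]]
  · change U (i x) * e = (f x).1
    rw [← mem_leftIdeal.1 (f x).2]
    congr 1
    -- Here `G (ε b (i x)) = tr (ε b (f x)) = tr (b (f x) e) = tr (b (f x))`: the adjoint `ε` of `e`
    -- is absorbed because `f x` lies in `B e`.
    refine huniq _ _ fun b => ?_
    have h1 : (f (X.act (ε * b) x)).1 = ε * b * (f x).1 := by rw [hf]; rfl
    rw [← hU, ← hi, hG, h1, mul_assoc, ← hε, mul_assoc, mem_leftIdeal.1 (f x).2]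

/-- The two-sided version of `isLeftSelfInjective_of_form`, with the adjunction given by a Nakayama
automorphism `ν`. -/
theorem isSelfInjective_of_form (tr : B →ₗ[k] k) (ν : B ≃ₗ[k] B)
    (hloc : ∀ s : Finset B, ∃ e : B, e * e = e ∧ ∀ b ∈ s, e * b = b ∧ b * e = b)
    (hν : ∀ a b, ν (a * b) = ν a * ν b)
    (hnd : ∀ u, (∀ b, tr (b * u) = 0) → u = 0)
    (hrep : ∀ (g : B →ₗ[k] k) (c d : B), ∃ u, ∀ b, g (c * b * d) = tr (b * u))
    (hnak : ∀ u e : B, tr (u * e) = tr (ν e * u)) :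
    IsSelfInjective.{w} k B := by
  refine ⟨hloc, isLeftSelfInjective_of_form tr hnd hrep fun e => ⟨ν e, fun u => hnak u e⟩,
    isLeftSelfInjective_of_form (tr ∘ₗ (MulOpposite.opLinearEquiv k).symm.toLinearMap) ?_ ?_ ?_⟩
  · intro u hu
    refine MulOpposite.unop_injective (hnd _ fun b => ?_)
    have h : tr (u.unop * ν.symm b) = 0 := hu (MulOpposite.op (ν.symm b))
    rwa [hnak, ν.apply_symm_apply] at h
  · intro g c d
    -- In the opposite algebra the representing element stands on the left of `b`. Moving it to the
    -- right replaces `b` by `ν b`, so `g` is precomposed with the inverse of `ν`.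
    obtain ⟨u, hu⟩ := hrep (g ∘ₗ (MulOpposite.opLinearEquiv k).toLinearMap ∘ₗ ν.symm.toLinearMap)
      (ν d.unop) (ν c.unop)
    refine ⟨MulOpposite.op u, fun b => ?_⟩
    have h := hu (ν b.unop)
    rw [← hν, ← hν] at h
    simp only [LinearMap.comp_apply, LinearEquiv.coe_coe, ν.symm_apply_apply] at h
    change _ = tr (u * b.unop)
    rw [hnak, ← h, mul_assoc d.unop]
    rfl
  · intro e
    refine ⟨MulOpposite.op (ν.symm e.unop), fun u => ?_⟩
    change tr (e.unop * u.unop) = tr (u.unop * ν.symm e.unop)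
    rw [hnak u.unop, ν.apply_symm_apply]

end Criterion

/-! ### Vertices as local identities of a bound quiver algebra -/

section Vertices

variable {k : Type*} [Field k] {V : Type u} [Quiver.{v} V]

lemma QPath.comp_nil (q : QPath V) (h : (QPath.nil q.src).tgt = q.src) :
    q.comp (QPath.nil q.src) h = q := by
  obtain ⟨a, b, p⟩ := q
  simp [QPath.comp, QPath.nil]

namespace BoundQuiver

variable (Q : BoundQuiver k V)

lemma path_mul_path (q p : QPath V) (h : p.tgt = q.src) :
    Q.path q * Q.path p = Q.path (q.comp p h) := by
  rw [path, path, ← AlgQuot.mk_mul, PathAlg.of_mul_of, PathAlg.mulPath, dif_pos h]; rfl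

lemma path_mul_path_of_ne (q p : QPath V) (h : p.tgt ≠ q.src) : Q.path q * Q.path p = 0 := by
  rw [path, path, ← AlgQuot.mk_mul, PathAlg.of_mul_of, PathAlg.mulPath, dif_neg h, map_zero]

lemma vertex_mul_path (i : V) (q : QPath V) :
    Q.vertex i * Q.path q = if i = q.tgt then Q.path q else 0 := by
  split_ifs with h
  · subst h
    exact Q.path_mul_path (QPath.nil q.tgt) q rfl
  · exact Q.path_mul_path_of_ne _ _ (Ne.symm h)

lemma path_mul_vertex (i : V) (q : QPath V) :
    Q.path q * Q.vertex i = if i = q.src then Q.path q else 0 := by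
  split_ifs with h
  · subst h
    exact (Q.path_mul_path q (QPath.nil q.src) rfl).trans (congrArg Q.path (q.comp_nil rfl))
  · exact Q.path_mul_path_of_ne _ _ h

lemma vertex_mul_vertex (i j : V) :
    Q.vertex i * Q.vertex j = if i = j then Q.vertex j else 0 :=
  Q.vertex_mul_path i (QPath.nil j)

variable {Q} in
lemma alg_induction {P : Q.Alg → Prop} (a : Q.Alg) (h0 : P 0)
    (hadd : ∀ a b, P a → P b → P (a + b)) (hsmul : ∀ (c : k) a, P a → P (c • a))
    (hpath : ∀ q, P (Q.path q)) : P a := by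
  obtain ⟨x, rfl⟩ := AlgQuot.mk_surjective k Q.rel a
  induction x using PathAlg.induction with
  | h0 => rwa [map_zero]
  | hadd f g hf hg => rw [map_add]; exact hadd _ _ hf hg
  | hof c q => rw [map_smul]; exact hsmul _ _ (hpath q)

/-- The sum of the idempotents of finitely many vertices. -/
def vertexSum (F : Finset V) : Q.Alg := ∑ i ∈ F, Q.vertex i

lemma vertexSum_mul_self (F : Finset V) : Q.vertexSum F * Q.vertexSum F = Q.vertexSum F := by
  simp only [vertexSum, Finset.sum_mul, Finset.mul_sum, vertex_mul_vertex]
  refine Finset.sum_congr rfl fun i hi => ?_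
  rw [Finset.sum_ite_eq' F i, if_pos hi]

/-- Quantifying over all larger `G` lets finitely many elements share one local identity; comparing
`F` with `insert i F` then shows that the remaining vertices annihilate `a`. -/
lemma exists_vertexSum (a : Q.Alg) : ∃ F : Finset V, ∀ G, F ⊆ G →
    Q.vertexSum G * a = a ∧ a * Q.vertexSum G = a := by
  induction a using alg_induction with
  | h0 => exact ⟨∅, fun G _ => by simp⟩
  | hadd a b ha hb =>
    obtain ⟨F, hF⟩ := ha
    obtain ⟨F', hF'⟩ := hb
    refine ⟨F ∪ F', fun G hG => ?_⟩
    obtain ⟨h1, h2⟩ := hF G (Finset.union_subset_left hG)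
    obtain ⟨h3, h4⟩ := hF' G (Finset.union_subset_right hG)
    rw [mul_add, add_mul, h1, h2, h3, h4]
    exact ⟨rfl, rfl⟩
  | hsmul c a ha =>
    obtain ⟨F, hF⟩ := ha
    refine ⟨F, fun G hG => ?_⟩
    rw [mul_smul_comm, smul_mul_assoc, (hF G hG).1, (hF G hG).2]
    exact ⟨rfl, rfl⟩
  | hpath q =>
    refine ⟨{q.src, q.tgt}, fun G hG => ?_⟩
    have h1 : q.src ∈ G := hG (by simp)
    have h2 : q.tgt ∈ G := hG (by simp)
    simp [vertexSum, Finset.sum_mul, Finset.mul_sum, vertex_mul_path, path_mul_vertex, h1, h2]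

lemma exists_vertexSum_dual (φ : localDual k Q.Alg) : ∃ F : Finset V, ∀ G, F ⊆ G →
    lAct k (Q.vertexSum G) φ.1 = φ.1 ∧ rAct k (Q.vertexSum G) φ.1 = φ.1 := by
  obtain ⟨φ, hφ⟩ := φ
  induction hφ using Submodule.span_induction with
  | mem φ h =>
    obtain ⟨a, b, f, rfl⟩ := h
    obtain ⟨F, hF⟩ := Q.exists_vertexSum a
    obtain ⟨F', hF'⟩ := Q.exists_vertexSum b
    refine ⟨F ∪ F', fun G hG => ?_⟩
    have h1 := (hF G (Finset.union_subset_left hG)).1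
    have h2 := (hF' G (Finset.union_subset_right hG)).2
    constructor <;> ext x
    · change f (b * (x * Q.vertexSum G) * a) = f (b * x * a)
      rw [mul_assoc, mul_assoc, h1, mul_assoc]
    · change f (b * (Q.vertexSum G * x) * a) = f (b * x * a)
      rw [← mul_assoc, h2]
  | zero => exact ⟨∅, fun G _ => by simp⟩
  | add φ ψ _ _ ha hb =>
    obtain ⟨F, hF⟩ := ha
    obtain ⟨F', hF'⟩ := hb
    refine ⟨F ∪ F', fun G hG => ?_⟩
    obtain ⟨h1, h2⟩ := hF G (Finset.union_subset_left hG)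
    obtain ⟨h3, h4⟩ := hF' G (Finset.union_subset_right hG)
    simp only at h1 h2 h3 h4 ⊢
    rw [map_add, map_add, h1, h2, h3, h4]
    exact ⟨rfl, rfl⟩
  | smul c a _ ha =>
    obtain ⟨F, hF⟩ := ha
    refine ⟨F, fun G hG => ?_⟩
    have := hF G hG
    simp only at this ⊢
    rw [map_smul, map_smul, this.1, this.2]
    exact ⟨rfl, rfl⟩

/-! ### The trace functional on `DΛ`. -/

lemma vertex_mul_eq_zero {F : Finset V} {a : Q.Alg}
    (hF : ∀ G, F ⊆ G → Q.vertexSum G * a = a) {i : V} (hi : i ∉ F) : Q.vertex i * a = 0 := by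
  have h1 := hF (insert i F) (Finset.subset_insert i F)
  rwa [vertexSum, Finset.sum_insert hi, add_mul, ← vertexSum, hF F subset_rfl,
    add_eq_right] at h1

/-- Without finite support `∑ᶠ` takes the default value `0`, and the trace would not be additive. -/
lemma finite_support_vertex (φ : localDual k Q.Alg) :
    (Function.support fun i => φ.1 (Q.vertex i)).Finite := by
  obtain ⟨F, hF⟩ := Q.exists_vertexSum_dual φ
  refine F.finite_toSet.subset fun i hi => ?_
  by_contra hiF
  have h1 := LinearMap.congr_fun (hF (insert i F) (Finset.subset_insert i F)).1 (Q.vertex i)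
  have h2 := LinearMap.congr_fun (hF F subset_rfl).1 (Q.vertex i)
  have e1 : Q.vertex i * Q.vertexSum F = 0 := by
    rw [vertexSum, Finset.mul_sum]
    refine Finset.sum_eq_zero fun j hj => ?_
    rw [vertex_mul_vertex, if_neg]
    rintro rfl
    exact hiF hj
  rw [lAct_apply, e1, map_zero] at h2
  exact hi h2.symm

/-- The functional `φ ↦ ∑ φ (e_i)`, evaluation at the identity of `Λ` if there is one. -/
def dualTrace : localDual k Q.Alg →ₗ[k] k where
  toFun φ := ∑ᶠ i, φ.1 (Q.vertex i)
  map_add' φ ψ := finsum_add_distrib (Q.finite_support_vertex φ) (Q.finite_support_vertex ψ)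
  map_smul' c φ := (smul_finsum c _).symm

/-- Only finitely many vertices act nontrivially on `a`, and their sum is a local identity for it.
-/
lemma dualTrace_lAct (a : Q.Alg) (φ : Q.Alg →ₗ[k] k) (h : lAct k a φ ∈ localDual k Q.Alg) :
    Q.dualTrace ⟨lAct k a φ, h⟩ = φ a := by
  obtain ⟨F, hF⟩ := Q.exists_vertexSum a
  change ∑ᶠ i, φ (Q.vertex i * a) = φ a
  rw [finsum_eq_sum_of_support_subset (s := F), ← map_sum, ← Finset.sum_mul,
    ← vertexSum, (hF F subset_rfl).1]
  intro i hi
  by_contra hiF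
  refine hi ?_
  change φ (Q.vertex i * a) = 0
  rw [Q.vertex_mul_eq_zero (fun G hG => (hF G hG).1) hiF, map_zero]

lemma dualTrace_rAct (a : Q.Alg) (φ : Q.Alg →ₗ[k] k) (h : rAct k a φ ∈ localDual k Q.Alg) :
    Q.dualTrace ⟨rAct k a φ, h⟩ = φ a := by
  obtain ⟨F, hF⟩ := Q.exists_vertexSum a
  change ∑ᶠ i, φ (a * Q.vertex i) = φ a
  rw [finsum_eq_sum_of_support_subset (s := F), ← map_sum, ← Finset.mul_sum,
    ← vertexSum, (hF F subset_rfl).2]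
  intro i hi
  by_contra hiF
  refine hi ?_
  have h1 := (hF (insert i F) (Finset.subset_insert i F)).2
  rw [vertexSum, Finset.sum_insert hiF, mul_add, ← vertexSum, (hF F subset_rfl).2,
    add_eq_right] at h1
  change φ (a * Q.vertex i) = 0
  rw [h1, map_zero]

/-! ### Blocks and their reflexivity. -/

lemma vertex_mul_mul_vertex_mem (i j : V) (a : Q.Alg) :
    Q.vertex j * a * Q.vertex i ∈ Q.block i j := by
  induction a using alg_induction with
  | h0 => simp
  | hadd a b ha hb => rw [mul_add, add_mul]; exact add_mem ha hb
  | hsmul c a ha => rw [mul_smul_comm, smul_mul_assoc]; exact Submodule.smul_mem _ _ ha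
  | hpath q =>
    rw [vertex_mul_path]
    split_ifs with h1
    · rw [path_mul_vertex]
      split_ifs with h2
      · exact Submodule.subset_span ⟨q, ⟨h2.symm, h1.symm⟩, rfl⟩
      · exact zero_mem _
    · rw [zero_mul]; exact zero_mem _

lemma vertex_mul_mul_vertex_of_mem {i j : V} {a : Q.Alg} (ha : a ∈ Q.block i j) :
    Q.vertex j * a * Q.vertex i = a := by
  induction ha using Submodule.span_induction with
  | mem a h =>
    obtain ⟨q, ⟨rfl, rfl⟩, rfl⟩ := h
    rw [vertex_mul_path, if_pos rfl, path_mul_vertex, if_pos rfl]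
  | zero => simp
  | add a b _ _ ha hb => rw [mul_add, add_mul, ha, hb]
  | smul c a _ ha => rw [mul_smul_comm, smul_mul_assoc, ha]

/-- Reflexivity of the blocks: a functional on `D Λ` that depends only on the restriction to
`e_j Λ e_i` is the evaluation at an element. -/
lemma exists_eval_eq (i j : V) [Module.Finite k (Q.block i j)] (h : localDual k Q.Alg →ₗ[k] k) :
    ∃ c : Q.Alg, ∀ φ : localDual k Q.Alg,
      h ⟨biAct k (Q.vertex i) (Q.vertex j) φ.1, biAct_mem k _ _ _⟩ = φ.1 c := by
  let π : Q.Alg →ₗ[k] Q.block i j :=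
    (LinearMap.mulRight k (Q.vertex i) ∘ₗ LinearMap.mulLeft k (Q.vertex j)).codRestrict _
      (Q.vertex_mul_mul_vertex_mem i j)
  have hπ : ∀ x : Q.block i j, π x.1 = x := fun x =>
    Subtype.ext (Q.vertex_mul_mul_vertex_of_mem x.2)
  have hππ : ∀ x, π (Q.vertex j * x * Q.vertex i) = π x := fun x => hπ (π x)
  -- Functionals on the block are extended to `Λ` through the projection `π`. Then `h ∘ₗ θ` lies in
  -- the double dual of the block, where finite dimensionality makes it an evaluation.
  let θ : Module.Dual k (Q.block i j) →ₗ[k] localDual k Q.Alg :=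
    (LinearMap.lcomp k k π).codRestrict _ fun f => by
      have : LinearMap.lcomp k k π f = biAct k (Q.vertex i) (Q.vertex j) (f ∘ₗ π) := by
        ext x
        exact congrArg f (hππ x).symm
      rw [this]
      exact biAct_mem k _ _ _
  refine ⟨((Module.evalEquiv k (Q.block i j)).symm (h ∘ₗ θ)).1, fun φ => ?_⟩
  have h1 := Module.apply_evalEquiv_symm_apply k (Q.block i j)
    (φ.1 ∘ₗ (Q.block i j).subtype) (h ∘ₗ θ)
  refine Eq.trans (congrArg h (Subtype.ext (LinearMap.ext fun x => ?_))) h1.symm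
  rfl

end BoundQuiver

end Vertices

/-! ### The Frobenius form of `Δ Λ # k ℤ^*` -/

section Form

variable {k : Type*} [Field k] {A : Type*} [NonUnitalRing A] [Module k A] [IsScalarTower k A A]
  [SMulCommClass k A A]

lemma TrivExt.component_fst (d : ℤ) (p : TrivExt k A) :
    (component (TrivExt.grade k A) d p).1 = if d = 0 then p.1 else 0 := by
  conv_lhs => rw [← TrivExt.part0_add_part1 p]
  rw [map_add, component_of_mem _ (TrivExt.part0 k A p).2,
    component_of_mem _ (TrivExt.part1 k A p).2, TrivExt.fst_add]
  split_ifs with h1 h2 h2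
  · exact add_zero _
  · exact add_zero _
  · exact add_zero _
  · exact add_zero _

lemma TrivExt.component_snd (d : ℤ) (p : TrivExt k A) (x : A) :
    (component (TrivExt.grade k A) d p).2.1 x = if d = 1 then p.2.1 x else 0 := by
  conv_lhs => rw [← TrivExt.part0_add_part1 p]
  rw [map_add, component_of_mem _ (TrivExt.part0 k A p).2,
    component_of_mem _ (TrivExt.part1 k A p).2, TrivExt.snd_add]
  split_ifs with h1 h2 h2
  · omega
  · exact add_zero _
  · exact zero_add _
  · exact add_zero _

/-- The coefficient `a_t` of `∑ a_t p_t`. -/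
def Smash.coeff (𝒜 : ℤ → Submodule k A) (t : ℤ) : Smash 𝒜 →ₗ[k] A :=
  Finsupp.lapply (M := A) t

lemma Smash.coeff_of (𝒜 : ℤ → Submodule k A) (s t : ℤ) (a : A) :
    Smash.coeff 𝒜 t (Smash.of 𝒜 s a) = if s = t then a else 0 :=
  Finsupp.single_apply

lemma Smash.ext_coeff {𝒜 : ℤ → Submodule k A} {x y : Smash 𝒜}
    (h : ∀ t, Smash.coeff 𝒜 t x = Smash.coeff 𝒜 t y) : x = y :=
  Finsupp.ext h

/-- The automorphism `a p_t ↦ a p_{t+1}` of a smash product. -/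
def Smash.shift (𝒜 : ℤ → Submodule k A) : Smash 𝒜 ≃ₗ[k] Smash 𝒜 :=
  Finsupp.domLCongr (Equiv.addRight (1 : ℤ))

lemma Smash.shift_of (𝒜 : ℤ → Submodule k A) (t : ℤ) (a : A) :
    Smash.shift 𝒜 (Smash.of 𝒜 t a) = Smash.of 𝒜 (t + 1) a :=
  Finsupp.domLCongr_single _ t a

/-- Only the difference of the two levels enters the product. -/
lemma Smash.shift_mul (𝒜 : ℤ → Submodule k A) [DirectSum.Decomposition 𝒜]
    [SetLike.GradedMul 𝒜] (x y : Smash 𝒜) :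
    Smash.shift 𝒜 (x * y) = Smash.shift 𝒜 x * Smash.shift 𝒜 y := by
  induction x using Smash.induction with
  | h0 => simp
  | hadd f g hf hg => simp only [add_mul, map_add, hf, hg]
  | hof s a =>
    induction y using Smash.induction with
    | h0 => simp
    | hadd f g hf hg => simp only [mul_add, map_add, hf, hg]
    | hof t b =>
      simp only [Smash.of_mul_of, Smash.shift_of]
      congr 4
      ring

namespace BoundQuiver

variable {V : Type u} [Quiver.{v} V] (Q : BoundQuiver k V)

/-- The functional `∑ (a_t, φ_t) p_t ↦ ∑ φ_t (1)` on `Δ Λ # k ℤ^*`. -/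
def smashTrace : Q.SmashAlg →ₗ[k] k :=
  Finsupp.lsum (M := TrivExt k Q.Alg) k fun _ =>
    Q.dualTrace ∘ₗ LinearMap.snd k Q.Alg (localDual k Q.Alg)

lemma smashTrace_of (t : ℤ) (p : TrivExt k Q.Alg) :
    Q.smashTrace (Smash.of _ t p) = Q.dualTrace p.2 :=
  Finsupp.lsum_single k _ t p

lemma dualTrace_mul (p q : TrivExt k Q.Alg) :
    Q.dualTrace (p * q).2 = q.2.1 p.1 + p.2.1 q.1 := by
  have h : (p * q).2 = (⟨lAct k p.1 q.2.1, lAct_mem k _ _ q.2.2⟩ : localDual k Q.Alg) +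
    ⟨rAct k q.1 p.2.1, rAct_mem k _ _ p.2.2⟩ := rfl
  rw [h, map_add, dualTrace_lAct, dualTrace_rAct]

/-- The product uses the component of `q` of degree `s - t`, which is its `DΛ`-part for `s = t + 1`
and its `Λ`-part for `s = t`. -/
lemma smashTrace_of_mul_of (s t : ℤ) (p q : TrivExt k Q.Alg) :
    Q.smashTrace (Smash.of _ s p * Smash.of _ t q) =
      (if s = t + 1 then q.2.1 p.1 else 0) + if s = t then p.2.1 q.1 else 0 := by
  rw [Smash.of_mul_of, smashTrace_of, dualTrace_mul, TrivExt.component_snd,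
    TrivExt.component_fst]
  congr 1
  · exact if_congr (by omega) rfl rfl
  · split_ifs
    · rfl
    · omega
    · omega
    · exact map_zero _

lemma smashTrace_of_mul (s : ℤ) (p : TrivExt k Q.Alg) (u : Q.SmashAlg) :
    Q.smashTrace (Smash.of _ s p * u) =
      (Smash.coeff _ (s - 1) u).2.1 p.1 + p.2.1 (Smash.coeff _ s u).1 := by
  induction u using Smash.induction with
  | h0 => simp
  | hadd f g hf hg =>
    rw [mul_add, map_add, hf, hg, map_add, map_add, TrivExt.fst_add, TrivExt.snd_add, map_add]
    ring
  | hof t q =>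
    rw [smashTrace_of_mul_of, Smash.coeff_of, Smash.coeff_of]
    congr 1
    · split_ifs
      · rfl
      · omega
      · omega
      · rfl
    · split_ifs
      · rfl
      · omega
      · omega
      · exact (map_zero _).symm

/-- The pairing on `ΔΛ` is symmetric; raising `e` by one level makes the conditions `s = t + 1` and
`s = t` change places along with the two summands. -/
lemma smashTrace_mul_comm (u e : Q.SmashAlg) :
    Q.smashTrace (u * e) = Q.smashTrace (Smash.shift _ e * u) := by
  induction u using Smash.induction with
  | h0 => simp
  | hadd f g hf hg => simp only [add_mul, mul_add, map_add, hf, hg]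
  | hof s p =>
    induction e using Smash.induction with
    | h0 => simp
    | hadd f g hf hg => simp only [add_mul, mul_add, map_add, hf, hg]
    | hof t q =>
      rw [Smash.shift_of, smashTrace_of_mul_of, smashTrace_of_mul_of, add_comm]
      congr 1
      · exact if_congr (by omega) rfl rfl
      · exact if_congr (by omega) rfl rfl

/-- An arbitrary functional need not lie in `DΛ`, but cutting it down by a local identity of `a`
puts it there without changing its value at `a`. -/
lemma eq_zero_of_dual (a : Q.Alg) (h : ∀ φ ∈ localDual k Q.Alg, φ a = 0) : a = 0 := by
  obtain ⟨F, hF⟩ := Q.exists_vertexSum a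
  refine (Module.forall_dual_apply_eq_zero_iff k a).1 fun f => ?_
  have := h _ (biAct_mem k (Q.vertexSum F) (Q.vertexSum F) f)
  change f (Q.vertexSum F * a * Q.vertexSum F) = 0 at this
  rwa [(hF F subset_rfl).1, (hF F subset_rfl).2] at this

/-- The coefficient at `t` is detected by two kinds of test elements: `φ p_t` sees its `Λ`-part and
`x p_{t+1}` its `DΛ`-part. -/
lemma smashTrace_nondegenerate (u : Q.SmashAlg) (h : ∀ b, Q.smashTrace (b * u) = 0) : u = 0 := by
  refine Smash.ext_coeff fun t => ?_
  rw [map_zero]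
  refine TrivExt.ext' (Q.eq_zero_of_dual _ fun φ hφ => ?_) fun x => ?_
  · have := h (Smash.of _ t (TrivExt.inr k Q.Alg ⟨φ, hφ⟩))
    rw [smashTrace_of_mul] at this
    change (Smash.coeff _ (t - 1) u).2.1 0 + φ _ = 0 at this
    rwa [map_zero, zero_add] at this
  · have := h (Smash.of _ (t + 1) (TrivExt.inl k Q.Alg x))
    rw [smashTrace_of_mul, add_sub_cancel_right] at this
    change _ + (0 : k) = 0 at this
    rwa [add_zero] at this

/-! ### Local identities of the smash product. -/

/-- The idempotent `e_i p_t` of `Δ Λ # k ℤ^*`. -/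
def smashVertex (x : V × ℤ) : Q.SmashAlg := Smash.of _ x.2 (TrivExt.inl k Q.Alg (Q.vertex x.1))

/-- The sum of the idempotents `e_i p_t` with `i` in `F` and `t` in `T`. -/
def smashVertexSum (F : Finset V) (T : Finset ℤ) : Q.SmashAlg :=
  ∑ t ∈ T, Smash.of _ t (TrivExt.inl k Q.Alg (Q.vertexSum F))

lemma smashVertexSum_eq (F : Finset V) (T : Finset ℤ) :
    Q.smashVertexSum F T = ∑ x ∈ F ×ˢ T, Q.smashVertex x := by
  rw [Finset.sum_product_right]
  refine Finset.sum_congr rfl fun t _ => ?_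
  simp only [smashVertex, vertexSum, map_sum]

lemma inl_mul_inl (a b : Q.Alg) :
    TrivExt.inl k Q.Alg a * TrivExt.inl k Q.Alg b = TrivExt.inl k Q.Alg (a * b) :=
  TrivExt.ext' rfl fun x => by
    rw [TrivExt.snd_mul]
    exact add_zero (0 : k)

lemma smashVertexSum_mul_self (F : Finset V) (T : Finset ℤ) :
    Q.smashVertexSum F T * Q.smashVertexSum F T = Q.smashVertexSum F T := by
  simp only [smashVertexSum, Finset.sum_mul, Finset.mul_sum, Smash.of_mul_of]
  refine Finset.sum_congr rfl fun t ht => ?_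
  rw [Finset.sum_eq_single t]
  · rw [component_of_mem _ (TrivExt.inl_mem _), if_pos (sub_self t), inl_mul_inl,
      vertexSum_mul_self]
  · intro s _ hs
    rw [component_of_mem _ (TrivExt.inl_mem _), if_neg (by omega), mul_zero, map_zero]
  · exact fun h => absurd ht h

lemma exists_vertexSum_trivExt (p : TrivExt k Q.Alg) : ∃ F : Finset V, ∀ G, F ⊆ G →
    TrivExt.inl k Q.Alg (Q.vertexSum G) * p = p ∧
      p * TrivExt.inl k Q.Alg (Q.vertexSum G) = p := by
  obtain ⟨F, hF⟩ := Q.exists_vertexSum p.1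
  obtain ⟨F', hF'⟩ := Q.exists_vertexSum_dual p.2
  refine ⟨F ∪ F', fun G hG => ?_⟩
  obtain ⟨h1, h2⟩ := hF G (Finset.union_subset_left hG)
  obtain ⟨h3, h4⟩ := hF' G (Finset.union_subset_right hG)
  refine ⟨TrivExt.ext' h1 fun x => ?_, TrivExt.ext' h2 fun x => ?_⟩
  · rw [TrivExt.snd_mul]
    exact (add_zero _).trans (LinearMap.congr_fun h3 x)
  · rw [TrivExt.snd_mul]
    exact (zero_add _).trans (LinearMap.congr_fun h4 x)

lemma exists_smashVertexSum (b : Q.SmashAlg) : ∃ (F : Finset V) (T : Finset ℤ), ∀ F' T',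
    F ⊆ F' → T ⊆ T' → Q.smashVertexSum F' T' * b = b ∧ b * Q.smashVertexSum F' T' = b := by
  have hadd : ∀ b c : Q.SmashAlg,
      (∃ (F : Finset V) (T : Finset ℤ), ∀ F' T', F ⊆ F' → T ⊆ T' →
        Q.smashVertexSum F' T' * b = b ∧ b * Q.smashVertexSum F' T' = b) →
      (∃ (F : Finset V) (T : Finset ℤ), ∀ F' T', F ⊆ F' → T ⊆ T' →
        Q.smashVertexSum F' T' * c = c ∧ c * Q.smashVertexSum F' T' = c) →
      ∃ (F : Finset V) (T : Finset ℤ), ∀ F' T', F ⊆ F' → T ⊆ T' →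
        Q.smashVertexSum F' T' * (b + c) = b + c ∧
          (b + c) * Q.smashVertexSum F' T' = b + c := by
    rintro b c ⟨F, T, h⟩ ⟨F₁, T₁, h₁⟩
    refine ⟨F ∪ F₁, T ∪ T₁, fun F' T' hF hT => ?_⟩
    obtain ⟨e1, e2⟩ := h F' T' (Finset.union_subset_left hF) (Finset.union_subset_left hT)
    obtain ⟨e3, e4⟩ := h₁ F' T' (Finset.union_subset_right hF) (Finset.union_subset_right hT)
    rw [mul_add, add_mul, e1, e2, e3, e4]
    exact ⟨rfl, rfl⟩
  have hhom : ∀ (t d : ℤ) (p : TrivExt k Q.Alg), p ∈ TrivExt.grade k Q.Alg d →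
      ∃ (F : Finset V) (T : Finset ℤ), ∀ F' T', F ⊆ F' → T ⊆ T' →
        Q.smashVertexSum F' T' * Smash.of _ t p = Smash.of _ t p ∧
          Smash.of _ t p * Q.smashVertexSum F' T' = Smash.of _ t p := by
    intro t d p hp
    obtain ⟨F, hF⟩ := Q.exists_vertexSum_trivExt p
    -- For `p` of degree `d`, the element `p p_t` is fixed by `p_t` on the right but by `p_{t+d}` on
    -- the left.
    refine ⟨F, {t, t + d}, fun F' T' hF' hT' => ?_⟩
    have ht : t ∈ T' := hT' (by simp)
    have htd : t + d ∈ T' := hT' (by simp)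
    obtain ⟨h1, h2⟩ := hF F' hF'
    rw [smashVertexSum, Finset.sum_mul, Finset.mul_sum]
    constructor
    · rw [Finset.sum_eq_single (t + d) _ fun h => absurd htd h]
      · rw [Smash.of_mul_of, component_of_mem _ hp, if_pos (by omega), h1]
      · intro s _ hs
        rw [Smash.of_mul_of, component_of_mem _ hp, if_neg (by omega), mul_zero, map_zero]
    · rw [Finset.sum_eq_single t _ fun h => absurd ht h]
      · rw [Smash.of_mul_of, component_of_mem _ (TrivExt.inl_mem _), if_pos (by omega), h2]
      · intro s _ hs
        rw [Smash.of_mul_of, component_of_mem _ (TrivExt.inl_mem _), if_neg (by omega),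
          mul_zero, map_zero]
  induction b using Smash.induction with
  | h0 => exact ⟨∅, ∅, fun _ _ _ _ => by simp⟩
  | hadd f g hf hg => exact hadd f g hf hg
  | hof t p =>
    rw [← TrivExt.part0_add_part1 p, map_add]
    exact hadd _ _ (hhom t 0 _ (TrivExt.part0 k Q.Alg p).2)
      (hhom t 1 _ (TrivExt.part1 k Q.Alg p).2)

lemma exists_local_identity (s : Finset Q.SmashAlg) :
    ∃ e : Q.SmashAlg, e * e = e ∧ ∀ b ∈ s, e * b = b ∧ b * e = b := by
  choose F T h using Q.exists_smashVertexSum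
  refine ⟨Q.smashVertexSum (s.biUnion F) (s.biUnion T), Q.smashVertexSum_mul_self _ _,
    fun b hb => h b _ _ (Finset.subset_biUnion_of_mem F hb) (Finset.subset_biUnion_of_mem T hb)⟩

/-! ### Representing local functionals by the form. -/

lemma smashVertex_mul_of_mul (j i : V) (s t r : ℤ) (p : TrivExt k Q.Alg) :
    Q.smashVertex (j, s) * Smash.of _ r p * Q.smashVertex (i, t) =
      if r = t then Smash.of _ t (TrivExt.inl k Q.Alg (Q.vertex j) *
        component (TrivExt.grade k Q.Alg) (s - t) p * TrivExt.inl k Q.Alg (Q.vertex i))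
      else 0 := by
  rw [smashVertex, smashVertex, Smash.of_mul_of, Smash.of_mul_of,
    component_of_mem _ (TrivExt.inl_mem _)]
  split_ifs with h1 h2 h2
  · subst h2; rfl
  · exact absurd (sub_eq_zero.1 h1) h2
  · exact absurd (sub_eq_zero.2 h2) h1
  · rw [mul_zero, map_zero]

lemma exists_repr_vertex (hfin : ∀ i j : V, Module.Finite k (Q.block i j))
    (g : Q.SmashAlg →ₗ[k] k) (x y : V × ℤ) :
    ∃ u, ∀ b, g (Q.smashVertex x * b * Q.smashVertex y) = Q.smashTrace (b * u) := by
  obtain ⟨j, s⟩ := x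
  obtain ⟨i, t⟩ := y
  suffices h : ∃ u, ∀ (r : ℤ) (p : TrivExt k Q.Alg),
      g (Q.smashVertex (j, s) * Smash.of _ r p * Q.smashVertex (i, t)) =
        Q.smashTrace (Smash.of _ r p * u) by
    obtain ⟨u, hu⟩ := h
    refine ⟨u, fun b => ?_⟩
    induction b using Smash.induction with
    | h0 => simp
    | hadd f g hf hg => simp only [mul_add, add_mul, map_add, hf, hg]
    | hof r p => exact hu r p
  simp only [smashVertex_mul_of_mul]
  by_cases h0 : s = t
  · subst h0
    -- On equal levels only the `Λ`-part of `p` survives, and it pairs with `DΛ` one level lower;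
    -- `g` itself, cut down to the block, is the required element of `DΛ`.
    refine ⟨Smash.of _ (s - 1) (TrivExt.inr k Q.Alg
      ⟨biAct k (Q.vertex i) (Q.vertex j) (g ∘ₗ Smash.of _ s ∘ₗ TrivExt.inl k Q.Alg),
        biAct_mem k _ _ _⟩), fun r p => ?_⟩
    rw [smashTrace_of_mul_of, sub_add_cancel]
    have h2 : (if r = s - 1 then p.2.1 (TrivExt.inr k Q.Alg
      ⟨biAct k (Q.vertex i) (Q.vertex j) (g ∘ₗ Smash.of _ s ∘ₗ TrivExt.inl k Q.Alg),
        biAct_mem k _ _ _⟩).1 else 0) = 0 := by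
      split_ifs
      · exact map_zero _
      · rfl
    rw [h2, add_zero]
    split_ifs with h
    · change _ = g (Smash.of _ s (TrivExt.inl k Q.Alg (Q.vertex j * p.1 * Q.vertex i)))
      congr 2
      refine TrivExt.ext' ?_ fun x => ?_
      · rw [TrivExt.fst_mul, TrivExt.fst_mul, TrivExt.component_fst, if_pos (sub_self s)]
        rfl
      · rw [TrivExt.snd_mul, TrivExt.snd_mul, TrivExt.component_snd, if_neg (by omega)]
        change 0 + ((0 : k) + 0) = 0
        simp
    · exact map_zero _
  · by_cases h1 : s = t + 1
    · subst h1
      -- Now only the `DΛ`-part survives, so a functional on the dual of a block must be represented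
      -- by an element of `Λ`: this is reflexivity.
      obtain ⟨c, hc⟩ := Q.exists_eval_eq j i (g ∘ₗ Smash.of _ t ∘ₗ TrivExt.inr k Q.Alg)
      refine ⟨Smash.of _ t (TrivExt.inl k Q.Alg c), fun r p => ?_⟩
      have h2 : (if r = t + 1 then (TrivExt.inl k Q.Alg c).2.1 p.1 else 0) = 0 := by
        split_ifs <;> rfl
      rw [smashTrace_of_mul_of, h2, zero_add]
      split_ifs with h
      · refine Eq.trans ?_ (hc p.2)
        change _ = g (Smash.of _ t (TrivExt.inr k Q.Alg _))
        congr 2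
        refine TrivExt.ext' ?_ fun x => ?_
        · rw [TrivExt.fst_mul, TrivExt.fst_mul, TrivExt.component_fst, if_neg (by omega),
            mul_zero, zero_mul]
          rfl
        · rw [TrivExt.snd_mul, TrivExt.snd_mul, TrivExt.component_snd, if_pos (by omega)]
          change (0 : k) + (p.2.1 (Q.vertex i * x * Q.vertex j) + 0) = _
          rw [zero_add, add_zero]
          rfl
      · exact map_zero _
    · refine ⟨0, fun r p => ?_⟩
      have h2 : component (TrivExt.grade k Q.Alg) (s - t) p = 0 :=
        TrivExt.ext' (by rw [TrivExt.component_fst, if_neg (by omega), TrivExt.fst_zero])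
          fun x => by rw [TrivExt.component_snd, if_neg (by omega), TrivExt.snd_zero]
      rw [h2]
      simp

theorem isSelfInjective_smash (hfin : ∀ i j : V, Module.Finite k (Q.block i j)) :
    IsSelfInjective.{w} k Q.SmashAlg := by
  refine isSelfInjective_of_form Q.smashTrace (Smash.shift _) Q.exists_local_identity
    (Smash.shift_mul _) Q.smashTrace_nondegenerate (fun g c d => ?_) Q.smashTrace_mul_comm
  obtain ⟨F, T, h⟩ := Q.exists_smashVertexSum c
  obtain ⟨F', T', h'⟩ := Q.exists_smashVertexSum d
  choose u hu using Q.exists_repr_vertex hfin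
    (g ∘ₗ LinearMap.mulRight k d ∘ₗ LinearMap.mulLeft k c)
  refine ⟨∑ x ∈ F ×ˢ T, ∑ y ∈ F' ×ˢ T', u x y, fun b => ?_⟩
  simp only [Finset.mul_sum, map_sum, ← hu]
  -- Local identities of `c` and `d`, expanded into vertices, reduce the claim to the functional `g
  -- (c · d)` cut down by vertex idempotents.
  have hc : c = ∑ x ∈ F ×ˢ T, c * Q.smashVertex x := by
    rw [← Finset.mul_sum, ← smashVertexSum_eq, (h F T subset_rfl subset_rfl).2]
  have hd : d = ∑ y ∈ F' ×ˢ T', Q.smashVertex y * d := by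
    rw [← Finset.sum_mul, ← smashVertexSum_eq, (h' F' T' subset_rfl subset_rfl).1]
  have hcbd : c * b * d = ∑ x ∈ F ×ˢ T, ∑ y ∈ F' ×ˢ T',
      c * (Q.smashVertex x * b * Q.smashVertex y) * d := by
    conv_lhs => rw [hc, hd, Finset.sum_mul, Finset.sum_mul_sum]
    simp only [mul_assoc]
  rw [hcbd]
  simp only [map_sum]
  rfl

end BoundQuiver

end Form

/-! ### The covering `ℤ|_{n-1} Q → Q̃` on paths -/

section Covering

variable {k : Type*} [Field k] {V : Type u} [Quiver.{v} V] {M : Set (QPath V)}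

/-- The vertex of the returning arrow quiver below a vertex of `ℤ|_{n-1} Q`. -/
abbrev ZVert.down (x : ZVert M) : Ret M := x.base

/-- The arrow of the returning arrow quiver below an arrow of `ℤ|_{n-1} Q`. -/
def downHom {x y : ZVert M} : (x ⟶ y) → (x.down ⟶ y.down)
  | .arrow _ α => .arrow α
  | .ret _ p => .ret p

/-- The path of the returning arrow quiver below a path of `ℤ|_{n-1} Q`. -/
def downAux {x : ZVert M} : {y : ZVert M} → Quiver.Path x y →
    Quiver.Path x.down y.down
  | _, .nil => .nil
  | _, .cons p a => (downAux p).cons (downHom a)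

/-- The path of the returning arrow quiver below a path of `ℤ|_{n-1} Q`. -/
def downPath (q : QPath (ZVert M)) : QPath (Ret M) := ⟨q.src.down, q.tgt.down, downAux q.path⟩

lemma downHom_liftHom (s : ℤ) {i j : Ret M} : (a : i ⟶ j) → downHom (liftHom s a).2 = a
  | .arrow _ => rfl
  | .ret _ => rfl

lemma liftHom_downHom {x y : ZVert M} :
    (a : x ⟶ y) → liftHom x.level (downHom a) = ⟨y.level, a⟩
  | .arrow _ _ => rfl
  | .ret _ _ => rfl

lemma downAux_liftAux (t : ℤ) {i j : Ret M} (p : Quiver.Path i j) :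
    downAux (liftAux t p).2 = p := by
  induction p with
  | nil => rfl
  | cons p a ih => simp only [liftAux, downAux, ih, downHom_liftHom]

/-- Unique path lifting: an arrow upstairs is determined by its image and its starting level, the
final level included. -/
lemma liftAux_downAux {x y : ZVert M} (p : Quiver.Path x y) :
    liftAux x.level (downAux p) = ⟨y.level, p⟩ := by
  induction p with
  | nil => rfl
  | cons p a ih =>
    simp only [liftAux, downAux]
    rw [ih]
    exact congrArg (fun z : (s : ℤ) × (_ ⟶ (⟨_, s⟩ : ZVert M)) =>
      (⟨z.1, p.cons z.2⟩ : (s : ℤ) × Quiver.Path x ⟨_, s⟩)) (liftHom_downHom a)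

lemma liftPath_downPath (q : QPath (ZVert M)) : liftPath q.src.level (downPath q) = q := by
  obtain ⟨x, y, p⟩ := q
  simp only [downPath, liftPath]
  rw [liftAux_downAux]

lemma liftPath_tgt (t : ℤ) (q : QPath (Ret M)) :
    (liftPath t q).tgt = ⟨q.tgt, t + retCount q⟩ := by
  simp only [liftPath, liftAux_level, retCount]

lemma liftAux_comp (t : ℤ) {i j l : Ret M} (p : Quiver.Path i j) (q : Quiver.Path j l) :
    liftAux t (p.comp q) =
      ⟨(liftAux (liftAux t p).1 q).1, (liftAux t p).2.comp (liftAux (liftAux t p).1 q).2⟩ := by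
  induction q with
  | nil => rfl
  | cons q a ih =>
    rw [Quiver.Path.comp_cons]
    simp only [liftAux]
    rw [ih]
    rfl

lemma liftPath_comp (t s : ℤ) (q p : QPath (Ret M)) (h : p.tgt = q.src)
    (h' : (liftPath t p).tgt = (liftPath s q).src) :
    liftPath t (q.comp p h) = (liftPath s q).comp (liftPath t p) h' := by
  obtain ⟨i, j, p⟩ := p
  obtain ⟨j', l, q⟩ := q
  cases h
  have hs : (liftAux t p).1 = s := congrArg ZVert.level h'
  subst hs
  simp only [liftPath, QPath.comp, Quiver.Path.cast_rfl_rfl]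
  rw [liftAux_comp]

lemma liftElem_of (t : ℤ) (q : QPath (Ret M)) :
    liftElem t (PathAlg.of k q) = PathAlg.of k (liftPath t q) :=
  PathAlg.lift_of k _ q

/-- The lift of `p` ends on level `t + retCount p`. This matching of levels mirrors the degree
condition in the smash product. -/
lemma liftElem_of_mul_of (t s : ℤ) (q p : QPath (Ret M)) :
    PathAlg.of k (liftPath s q) * PathAlg.of k (liftPath t p) =
      if s = t + retCount p then liftElem t (PathAlg.of k q * PathAlg.of k p) else 0 := by
  rw [PathAlg.of_mul_of, PathAlg.of_mul_of, PathAlg.mulPath, PathAlg.mulPath]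
  have key : (liftPath t p).tgt = (liftPath s q).src ↔ p.tgt = q.src ∧ s = t + retCount p := by
    rw [liftPath_tgt]
    change (⟨p.tgt, _⟩ : ZVert M) = ⟨q.src, s⟩ ↔ _
    exact ⟨fun h => ⟨congrArg ZVert.base h, (congrArg ZVert.level h).symm⟩, fun h => by
      rw [h.2]; exact congrArg (fun i => (⟨i, t + retCount p⟩ : ZVert M)) h.1⟩
  by_cases hs : s = t + retCount p
  · rw [if_pos hs]
    by_cases h : p.tgt = q.src
    · rw [dif_pos (key.2 ⟨h, hs⟩), dif_pos h, liftElem_of, liftPath_comp t s q p h]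
    · rw [dif_neg fun h' => h (key.1 h').1, dif_neg h, map_zero]
  · rw [if_neg hs, dif_neg fun h' => hs (key.1 h').2]

lemma liftElem_mul_of (t : ℤ) (x : PathAlg k (Ret M)) (p : QPath (Ret M)) :
    liftElem t (x * PathAlg.of k p) =
      liftElem (t + retCount p) x * PathAlg.of k (liftPath t p) := by
  induction x using PathAlg.induction with
  | h0 => simp
  | hadd f g hf hg => simp only [add_mul, map_add, hf, hg]
  | hof c q =>
    rw [smul_mul_assoc, map_smul, map_smul, smul_mul_assoc, liftElem_of, liftElem_of_mul_of,
      if_pos rfl]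

/-- The lifted terms of `x` may end on different levels, so one lift of `q` is not enough; lifts on
superfluous levels multiply to zero. -/
lemma liftElem_of_mul (t : ℤ) (q : QPath (Ret M)) (x : PathAlg k (Ret M)) :
    ∃ S : Finset ℤ, ∀ S', S ⊆ S' → liftElem t (PathAlg.of k q * x) =
      (∑ s ∈ S', PathAlg.of k (liftPath s q)) * liftElem t x := by
  induction x using PathAlg.induction with
  | h0 => exact ⟨∅, fun _ _ => by simp⟩
  | hadd f g hf hg =>
    obtain ⟨S, hS⟩ := hf
    obtain ⟨S₁, hS₁⟩ := hg
    refine ⟨S ∪ S₁, fun S' h => ?_⟩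
    rw [mul_add, map_add, map_add, mul_add, hS S' (Finset.union_subset_left h),
      hS₁ S' (Finset.union_subset_right h)]
  | hof c p =>
    refine ⟨{t + (retCount p : ℤ)}, fun S' h => ?_⟩
    rw [mul_smul_comm, map_smul, map_smul, mul_smul_comm, Finset.sum_mul, liftElem_of,
      Finset.sum_eq_single (t + (retCount p : ℤ)), liftElem_of_mul_of, if_pos rfl]
    · intro s _ hs
      rw [liftElem_of_mul_of, if_neg hs]
    · exact fun hs => absurd (h (Finset.mem_singleton_self _)) hs

/-- Lifting sends an ideal into an ideal that contains the lifts of its generators. -/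
lemma liftElem_mem_idealSpan {S : Set (PathAlg k (Ret M))} {J : Set (PathAlg k (ZVert M))}
    (hS : ∀ x ∈ S, ∀ t, liftElem t x ∈ idealSpan k J) {x : PathAlg k (Ret M)}
    (hx : x ∈ idealSpan k S) (t : ℤ) : liftElem t x ∈ idealSpan k J := by
  have h : idealSpan k S ≤ ⨅ t : ℤ, (idealSpan k J).comap (liftElem t) := by
    refine idealSpan_le k _ _ (fun x hx => ?_) fun a x hx => ?_
    · simp only [SetLike.mem_coe, Submodule.mem_iInf, Submodule.mem_comap]
      exact hS x hx
    · simp only [Submodule.mem_iInf, Submodule.mem_comap] at hx ⊢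
      induction a using PathAlg.induction with
      | h0 => simp
      | hadd f g hf hg =>
        simp only [add_mul, mul_add, map_add]
        exact ⟨fun t => add_mem (hf.1 t) (hg.1 t), fun t => add_mem (hf.2 t) (hg.2 t)⟩
      | hof c q =>
        simp only [smul_mul_assoc, mul_smul_comm, map_smul]
        refine ⟨fun t => Submodule.smul_mem _ _ ?_, fun t => Submodule.smul_mem _ _ ?_⟩
        · obtain ⟨S, hS⟩ := liftElem_of_mul t q x
          rw [hS S subset_rfl]
          exact (idealSpan_mul_mem k _ _ _ (hx t)).1
        · rw [liftElem_mul_of]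
          exact (idealSpan_mul_mem k _ _ _ (hx _)).2
  have := h hx
  simp only [Submodule.mem_iInf, Submodule.mem_comap] at this
  exact this t

lemma exists_eq_sum_liftElem (y : PathAlg k (ZVert M)) :
    ∃ f : ℤ →₀ PathAlg k (Ret M), y = f.sum fun t x => liftElem t x := by
  induction y using PathAlg.induction with
  | h0 => exact ⟨0, by simp⟩
  | hadd y z hy hz =>
    obtain ⟨f, rfl⟩ := hy
    obtain ⟨g, rfl⟩ := hz
    exact ⟨f + g, (Finsupp.sum_add_index' (by simp) (by simp)).symm⟩
  | hof c q =>
    refine ⟨Finsupp.single q.src.level (c • PathAlg.of k (downPath q)), ?_⟩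
    rw [Finsupp.sum_single_index (by simp), map_smul, liftElem_of, liftPath_downPath]

end Covering

/-! ### The isomorphism -/

section Iso

variable {k : Type*} [Field k] {V : Type u} [Quiver.{v} V] {M : Set (QPath V)}

namespace BoundQuiver

variable {Q : BoundQuiver k V} (hM : Q.IsMaximalIndep M)

lemma inl_vertex_mul_inr_biAct (i j : V) (f : Q.Alg →ₗ[k] k) :
    TrivExt.inl k Q.Alg (Q.vertex i) *
      TrivExt.inr k Q.Alg ⟨biAct k (Q.vertex i) (Q.vertex j) f, biAct_mem k _ _ _⟩ =
      TrivExt.inr k Q.Alg ⟨biAct k (Q.vertex i) (Q.vertex j) f, biAct_mem k _ _ _⟩ := by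
  refine TrivExt.ext' (mul_zero _) fun x => (add_zero _).trans ?_
  change f (Q.vertex j * (x * Q.vertex i) * Q.vertex i) = f (Q.vertex j * x * Q.vertex i)
  rw [← mul_assoc, mul_assoc _ _ (Q.vertex i), vertex_mul_vertex, if_pos rfl]

lemma inr_biAct_mul_inl_vertex (i j : V) (f : Q.Alg →ₗ[k] k) :
    TrivExt.inr k Q.Alg ⟨biAct k (Q.vertex i) (Q.vertex j) f, biAct_mem k _ _ _⟩ *
      TrivExt.inl k Q.Alg (Q.vertex j) =
      TrivExt.inr k Q.Alg ⟨biAct k (Q.vertex i) (Q.vertex j) f, biAct_mem k _ _ _⟩ := by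
  refine TrivExt.ext' (zero_mul _) fun x => (zero_add _).trans ?_
  change f (Q.vertex j * (Q.vertex j * x) * Q.vertex i) = f (Q.vertex j * x * Q.vertex i)
  rw [← mul_assoc, vertex_mul_vertex, if_pos rfl]

variable (Q) in
/-- The idempotent `(e_i, 0)` of `Δ Λ` at a vertex of the returning arrow quiver. -/
def retVertex (i : Ret M) : TrivExt k Q.Alg := TrivExt.inl k Q.Alg (Q.vertex i)

lemma retVertex_mul_retVertex (i j : Ret M) :
    retVertex Q i * retVertex Q j = if i = j then retVertex Q j else 0 := by
  refine ((Q.inl_mul_inl _ _).trans (congrArg _ (Q.vertex_mul_vertex i j))).trans ?_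
  by_cases h : i = j
  · rw [if_pos h]
    exact congrArg _ (if_pos h)
  · rw [if_neg h]
    exact (congrArg _ (if_neg h)).trans (map_zero _)

lemma retVertex_mul_retValue {i j : Ret M} :
    (a : i ⟶ j) → retVertex Q j * retValue hM a = retValue hM a
  | .arrow α => (Q.inl_mul_inl _ _).trans
    (congrArg _ ((Q.vertex_mul_path _ (QPath.arrow α)).trans (if_pos rfl)))
  | .ret p => inl_vertex_mul_inr_biAct _ _ _

lemma retValue_mul_retVertex {i j : Ret M} :
    (a : i ⟶ j) → retValue hM a * retVertex Q i = retValue hM a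
  | .arrow α => (Q.inl_mul_inl _ _).trans
    (congrArg _ ((Q.path_mul_vertex _ (QPath.arrow α)).trans (if_pos rfl)))
  | .ret p => inr_biAct_mul_inl_vertex _ _ _

lemma retVertex_mul_pathValue {i j : Ret M} (p : Quiver.Path i j) :
    retVertex Q j * pathValue hM p = pathValue hM p := by
  cases p with
  | nil => exact (retVertex_mul_retVertex i i).trans (if_pos rfl)
  | cons p a => rw [pathValue, ← mul_assoc, retVertex_mul_retValue]

lemma pathValue_mul_retVertex {i j : Ret M} (p : Quiver.Path i j) :
    pathValue hM p * retVertex Q i = pathValue hM p := by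
  induction p with
  | nil => exact (retVertex_mul_retVertex i i).trans (if_pos rfl)
  | cons p a ih => rw [pathValue, mul_assoc, ih]

lemma pathValue_comp {i j l : Ret M} (p : Quiver.Path i j) (q : Quiver.Path j l) :
    pathValue hM (p.comp q) = pathValue hM q * pathValue hM p := by
  induction q with
  | nil => exact (retVertex_mul_pathValue hM p).symm
  | cons q a ih => rw [Quiver.Path.comp_cons, pathValue, pathValue, ih, mul_assoc]

lemma pathValue_mul_of_ne {i j i' j' : Ret M} (p : Quiver.Path i j) (q : Quiver.Path i' j')
    (h : j ≠ i') : pathValue hM q * pathValue hM p = 0 := by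
  rw [← pathValue_mul_retVertex hM q, ← retVertex_mul_pathValue hM p, mul_assoc,
    ← mul_assoc (retVertex Q _), retVertex_mul_retVertex, if_neg (Ne.symm h), zero_mul, mul_zero]

lemma retValue_mem {i j : Ret M} :
    (a : i ⟶ j) → retValue hM a ∈ TrivExt.grade k Q.Alg (retDeg a)
  | .arrow α => TrivExt.inl_mem _
  | .ret p => TrivExt.inr_mem _

/-- This identifies the change of level along a lifted path with the degree of its value, which
makes `smashMap` multiplicative. -/
lemma pathValue_mem {i j : Ret M} (p : Quiver.Path i j) :
    pathValue hM p ∈ TrivExt.grade k Q.Alg (retCountAux p) := by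
  induction p with
  | nil => exact TrivExt.inl_mem _
  | cons p a ih =>
    have h := SetLike.GradedMul.mul_mem (retValue_mem hM a) ih
    rw [pathValue, retCountAux]
    push_cast
    rwa [add_comm]

lemma mu_of (q : QPath (Ret M)) : mu hM (PathAlg.of k q) = pathValue hM q.path :=
  PathAlg.lift_of k _ q

lemma mu_quadPart_mem (d : ℕ) {x : PathAlg k (Ret M)} (hx : x ∈ quadPart k M d) :
    mu hM x ∈ TrivExt.grade k Q.Alg d := by
  induction hx using Submodule.span_induction with
  | mem x h =>
    obtain ⟨q, ⟨-, rfl⟩, rfl⟩ := h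
    rw [mu_of]
    exact pathValue_mem hM q.path
  | zero => simp
  | add x y _ _ hx hy => rw [map_add]; exact add_mem hx hy
  | smul c x _ hx => rw [map_smul]; exact Submodule.smul_mem _ _ hx

/-! ### The homomorphism on the path algebra of the covering. -/

/-- The map `k (ℤ|_{n-1} Q) → Δ Λ # k ℤ^*` before passing to the quotient. -/
def smashMap : PathAlg k (ZVert M) →ₗ[k] Q.SmashAlg :=
  PathAlg.lift fun q => Smash.of _ q.src.level (pathValue hM (downAux q.path))

lemma smashMap_of (q : QPath (ZVert M)) : smashMap hM (PathAlg.of k q) =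
    Smash.of _ q.src.level (pathValue hM (downAux q.path)) :=
  PathAlg.lift_of k _ q

lemma smashMap_of_liftPath (t : ℤ) (q : QPath (Ret M)) :
    smashMap hM (PathAlg.of k (liftPath t q)) = Smash.of _ t (pathValue hM q.path) := by
  rw [smashMap_of, liftPath, downAux_liftAux]

lemma smashMap_liftElem (t : ℤ) (x : PathAlg k (Ret M)) :
    smashMap hM (liftElem t x) = Smash.of _ t (mu hM x) := by
  induction x using PathAlg.induction with
  | h0 => simp
  | hadd f g hf hg => simp only [map_add, hf, hg]
  | hof c q => rw [map_smul, map_smul, map_smul, map_smul, liftElem_of, smashMap_of_liftPath, mu_of]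

lemma mu_of_mul_of (q p : QPath (Ret M)) :
    mu hM (PathAlg.of k q * PathAlg.of k p) = pathValue hM q.path * pathValue hM p.path := by
  obtain ⟨i, j, p⟩ := p
  obtain ⟨j', l, q⟩ := q
  rw [PathAlg.of_mul_of, PathAlg.mulPath]
  split_ifs with h
  · cases h
    rw [mu_of]
    exact pathValue_comp hM p q
  · rw [map_zero, pathValue_mul_of_ne hM p q h]

lemma smashMap_mul (x y : PathAlg k (ZVert M)) :
    smashMap hM (x * y) = smashMap hM x * smashMap hM y := by
  induction x using PathAlg.induction with
  | h0 => simp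
  | hadd f g hf hg => simp only [add_mul, map_add, hf, hg]
  | hof c q =>
    rw [smul_mul_assoc, map_smul, map_smul, smul_mul_assoc]
    congr 1
    induction y using PathAlg.induction with
    | h0 => simp
    | hadd f g hf hg => simp only [mul_add, map_add, hf, hg]
    | hof d p =>
      rw [mul_smul_comm, map_smul, map_smul, mul_smul_comm]
      congr 1
      rw [← liftPath_downPath q, ← liftPath_downPath p]
      generalize q.src.level = s
      generalize p.src.level = t
      generalize downPath q = q
      generalize downPath p = p
      rw [smashMap_of_liftPath, smashMap_of_liftPath, Smash.of_mul_of, liftElem_of_mul_of,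
        component_of_mem _ (pathValue_mem hM p.path)]
      by_cases h : s = t + retCount p
      · rw [if_pos h, if_pos (by rw [h, add_sub_cancel_left]; rfl), smashMap_liftElem,
          mu_of_mul_of]
      · rw [if_neg h, if_neg fun h' => h (by rw [← sub_eq_iff_eq_add']; exact h'), mul_zero,
          map_zero, map_zero]

/-! ### The kernel, and the isomorphism on the quotient. -/

lemma quadPart_two_le_ker : quadPart k M 2 ≤ LinearMap.ker (mu hM) := fun x hx => by
  have h := TrivExt.mem_grade.1 (mu_quadPart_mem hM 2 hx)
  exact Prod.ext (h.1 (by norm_num)) (h.2 (by norm_num))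

lemma rhoM_span : Submodule.span k (rhoM k M) = quadPart k M 2 := rfl

lemma retDeg_le {i j : Ret M} : (a : i ⟶ j) → retDeg a ≤ 1
  | .arrow _ => Nat.zero_le 1
  | .ret _ => le_rfl

lemma retCountAux_le {i j : Ret M} (p : Quiver.Path i j) : retCountAux p ≤ p.length := by
  induction p with
  | nil => exact le_rfl
  | cons p a ih => exact add_le_add ih (retDeg_le a)

/-- A quadratic element of the kernel of `μ` is a sum of elements of the kernel in the three
subspaces `V ⊗ V`, `V ⊗ V_M + V_M ⊗ V` and `V_M ⊗ V_M`. -/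
lemma mem_span_of_mem_ker (R : QuadRel hM) {x : PathAlg k (Ret M)} (hx : mu hM x = 0)
    (hx2 : x ∈ PathAlg.supp k {q : QPath (Ret M) | q.length = 2}) :
    x ∈ Submodule.span k (R.rho ∪ rhoM k M ∪ R.rho0) := by
  have hdec : x ∈ quadPart k M 0 ⊔ quadPart k M 1 ⊔ quadPart k M 2 := by
    refine Submodule.span_le.2 ?_ hx2
    rintro _ ⟨q, hq, rfl⟩
    have h2 : retCount q ≤ 2 := (retCountAux_le q.path).trans hq.le
    have hmem : PathAlg.of k q ∈ quadPart k M (retCount q) :=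
      Submodule.subset_span ⟨q, ⟨hq, rfl⟩, rfl⟩
    generalize retCount q = d at h2 hmem
    interval_cases d
    · exact Submodule.mem_sup_left (Submodule.mem_sup_left hmem)
    · exact Submodule.mem_sup_left (Submodule.mem_sup_right hmem)
    · exact Submodule.mem_sup_right hmem
  obtain ⟨y, hy, x2, h2, rfl⟩ := Submodule.mem_sup.1 hdec
  obtain ⟨x0, h0, x1, h1, rfl⟩ := Submodule.mem_sup.1 hy
  have e0 := TrivExt.mem_grade.1 (mu_quadPart_mem hM 0 h0)
  have e1 := TrivExt.mem_grade.1 (mu_quadPart_mem hM 1 h1)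
  rw [map_add, map_add, show mu hM x2 = 0 from quadPart_two_le_ker hM h2, add_zero] at hx
  -- The values of `x0` and `x1` lie in the complementary summands `Λ` and `DΛ`, so their sum
  -- vanishes only if both do.
  have f0 : (mu hM x0).1 = 0 := by
    have h : (mu hM x0).1 + (mu hM x1).1 = 0 := congrArg Prod.fst hx
    rwa [e1.1 (by norm_num), add_zero] at h
  have f1 : (mu hM x1).2 = 0 := by
    have h : (mu hM x0).2 + (mu hM x1).2 = 0 := congrArg Prod.snd hx
    rwa [e0.2 (by norm_num), zero_add] at h
  have k0 : mu hM x0 = 0 := Prod.ext f0 (e0.2 (by norm_num))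
  have k1 : mu hM x1 = 0 := Prod.ext (e1.1 (by norm_num)) f1
  rw [Submodule.span_union, Submodule.span_union, R.span_rho, R.span_rho0, rhoM_span]
  exact add_mem (add_mem (Submodule.mem_sup_left (Submodule.mem_sup_left ⟨k0, h0⟩))
    (Submodule.mem_sup_right ⟨k1, h1⟩)) (Submodule.mem_sup_left (Submodule.mem_sup_right h2))

lemma ker_smashMap (hquad : IsQuadraticTrivExt hM) (R : QuadRel hM) :
    LinearMap.ker (smashMap hM) = idealSpan k (ZQuiver R).rel := by
  apply le_antisymm
  · intro y hy
    obtain ⟨f, rfl⟩ := exists_eq_sum_liftElem y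
    -- Lifts from different starting levels have different `p_t` as coefficient positions, so
    -- nothing cancels between levels.
    have hf : ∀ t, mu hM (f t) = 0 := by
      intro t
      have h : Smash.coeff _ t (smashMap hM (f.sum fun t x => liftElem t x)) = 0 := by
        rw [LinearMap.mem_ker.1 hy, map_zero]
      simp only [Finsupp.sum, map_sum, smashMap_liftElem, Smash.coeff_of] at h
      rw [Finset.sum_ite_eq' f.support t] at h
      by_cases ht : t ∈ f.support
      · rwa [if_pos ht] at h
      · rw [Finsupp.notMem_support_iff.1 ht, map_zero]
    refine Submodule.sum_mem _ fun t _ => ?_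
    have h : f t ∈ LinearMap.ker (mu hM) := hf t
    -- Quadraticity enters here: it is enough to lift the generators of length 2.
    rw [hquad.2] at h
    refine liftElem_mem_idealSpan (fun x hx s => ?_) h t
    have hx' := mem_span_of_mem_ker hM R hx.1 hx.2
    have hle : Submodule.span k (R.rho ∪ rhoM k M ∪ R.rho0) ≤
        (idealSpan k (ZQuiver R).rel).comap (liftElem s) :=
      Submodule.span_le.2 fun z hz => subset_idealSpan k _ ⟨s, z, hz, rfl⟩
    exact hle hx'
  · refine idealSpan_le k _ _ ?_ fun a x hx => ?_
    · rintro _ ⟨t, x, hx, rfl⟩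
      have h : mu hM x = 0 := by
        rcases hx with (hx | hx) | hx
        · have h := Submodule.subset_span (R := k) hx
          rw [R.span_rho] at h
          exact h.1
        · exact quadPart_two_le_ker hM (Submodule.subset_span hx)
        · have h := Submodule.subset_span (R := k) hx
          rw [R.span_rho0] at h
          exact h.1
      exact LinearMap.mem_ker.2 (by rw [smashMap_liftElem, h, map_zero])
    · rw [LinearMap.mem_ker] at hx
      constructor <;> rw [LinearMap.mem_ker, smashMap_mul, hx]
      · exact mul_zero _
      · exact zero_mul _

lemma smashMap_surjective (hsurj : Function.Surjective (mu hM)) :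
    Function.Surjective (smashMap hM) := by
  intro b
  induction b using Smash.induction with
  | h0 => exact ⟨0, map_zero _⟩
  | hadd f g hf hg =>
    obtain ⟨x, rfl⟩ := hf
    obtain ⟨y, rfl⟩ := hg
    exact ⟨x + y, map_add _ _ _⟩
  | hof t p =>
    obtain ⟨x, rfl⟩ := hsurj p
    exact ⟨liftElem t x, smashMap_liftElem hM t x⟩

/-- The homomorphism `k (ℤ|_{n-1} Q) / (ρ) → Δ Λ # k ℤ^*`. -/
def smashHom (hquad : IsQuadraticTrivExt hM) (R : QuadRel hM) :
    (ZQuiver R).Alg →ₙₐ[k] Q.SmashAlg :=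
  let F : (ZQuiver R).Alg →ₗ[k] Q.SmashAlg :=
    (idealSpan k (ZQuiver R).rel).liftQ (smashMap hM) (ker_smashMap hM hquad R).ge
  { F with
    map_zero' := map_zero F
    map_mul' := fun a b => by
      obtain ⟨x, rfl⟩ := AlgQuot.mk_surjective k _ a
      obtain ⟨y, rfl⟩ := AlgQuot.mk_surjective k _ b
      exact smashMap_mul hM x y }

lemma smashHom_mk (hquad : IsQuadraticTrivExt hM) (R : QuadRel hM) (x : PathAlg k (ZVert M)) :
    smashHom hM hquad R (AlgQuot.mk k _ x) = smashMap hM x := rfl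

lemma smashHom_bijective (hquad : IsQuadraticTrivExt hM) (R : QuadRel hM) :
    Function.Bijective (smashHom hM hquad R) := by
  constructor
  · intro a b h
    obtain ⟨x, rfl⟩ := AlgQuot.mk_surjective k _ a
    obtain ⟨y, rfl⟩ := AlgQuot.mk_surjective k _ b
    rw [smashHom_mk, smashHom_mk, ← sub_eq_zero, ← map_sub] at h
    rw [AlgQuot.mk_eq_iff, ← ker_smashMap hM hquad R]
    exact h
  · intro b
    obtain ⟨x, rfl⟩ := smashMap_surjective hM hquad.1 b
    exact ⟨AlgQuot.mk k _ x, rfl⟩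

lemma smashHom_path (hquad : IsQuadraticTrivExt hM) (R : QuadRel hM) (q : QPath (ZVert M)) :
    smashHom hM hquad R ((ZQuiver R).path q) =
      Smash.of _ q.src.level (pathValue hM (downAux q.path)) := by
  rw [path, smashHom_mk, smashMap_of]

lemma smashHom_arrow (hquad : IsQuadraticTrivExt hM) (R : QuadRel hM) {x y : ZVert M}
    (a : x ⟶ y) : smashHom hM hquad R ((ZQuiver R).arrow a) =
      Smash.of _ x.level (retValue hM (downHom a)) := by
  -- The value of a path of length one carries the source idempotent as a right factor.
  rw [arrow, smashHom_path, ← retValue_mul_retVertex hM (downHom a)]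
  rfl

end BoundQuiver

end Iso

end QuiverAlg

end

open QuiverAlg

theorem proposition6p2 {k : Type uk} [Field k] {V : Type u} [Quiver.{v} V]
    (Q : BoundQuiver k V) (n : ℕ)
    (hacyclic : Q.IsAcyclic) (hhom : Q.IsHomogeneous n)
    (hfin : ∀ i j : V, Module.Finite k (Q.block i j))
    (M : Set (QPath V)) (hM : Q.IsMaximalIndep M)
    (hquad : BoundQuiver.IsQuadraticTrivExt hM)
    (R : BoundQuiver.QuadRel hM) :
    IsSelfInjective.{w} k Q.SmashAlg ∧
      ∃ Φ : (BoundQuiver.ZQuiver R).Alg →ₙₐ[k] Q.SmashAlg,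
        Function.Bijective Φ ∧
        (∀ (i : V) (t : ℤ), Φ ((BoundQuiver.ZQuiver R).vertex ⟨i, t⟩) =
          Smash.of _ t (TrivExt.inl k Q.Alg (Q.vertex i))) ∧
        (∀ (i j : V) (α : i ⟶ j) (t : ℤ),
          Φ ((BoundQuiver.ZQuiver R).arrow (ZHom.arrow (M := M) t α)) =
            Smash.of _ t (TrivExt.inl k Q.Alg (Q.arrow α))) ∧
        (∀ (p : M) (t : ℤ),
          Φ ((BoundQuiver.ZQuiver R).arrow (ZHom.ret (M := M) t p)) =
            Smash.of _ t (TrivExt.inr k Q.Alg (BoundQuiver.dual hM p))) :=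
  ⟨Q.isSelfInjective_smash hfin, BoundQuiver.smashHom hM hquad R,
    BoundQuiver.smashHom_bijective hM hquad R,
    fun i t => BoundQuiver.smashHom_path hM hquad R (QPath.nil ⟨i, t⟩),
    fun _ _ α t => BoundQuiver.smashHom_arrow hM hquad R (ZHom.arrow t α),
    fun p t => BoundQuiver.smashHom_arrow hM hquad R (ZHom.ret t p)⟩
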